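/- Let $(\mathcal C,\mathbb E,\mathfrak s)$ be an essentially small extriangulated category (in the sense of Nakaoka--Palu) and let $I$ be a non-empty set. For $\eta\in\mathbb E(A,B)$, $f:A'\to A$ and $g:B\to B'$ write $\eta\cdot f=\mathbb E(f,B)(\eta)$ and $g\cdot\eta=\mathbb E(A,g)(\eta)$, and similarly for $\mathbb E^n$, where $\mathbb E^1=\mathbb E$ and $\mathbb E^{n+1}(A,B)=\int^{M\in\mathcal C}\mathbb E(M,B)\otimes_{\mathbb Z}\mathbb E^n(A,M)$. Let $\mathcal D=\mathrm{Fun}(I,\mathcal C)$ be the product category of the discrete category $I$, with $\mathbb F(X,Y)=\prod_{i\in I}\mathbb E(X_i,Y_i)$ and $\mathfrak t=\prod_{i\in I}\mathfrak s$, and let $T:\mathcal C\to\mathcal D$ be the constant functor. An extriangulated functor $F:(\mathcal C_1,\mathbb E_1,\mathfrak s_1)\to(\mathcal C_2,\mathbb E_2,\mathfrak s_2)$ is an additive functor with a natural transformation $\Gamma_F:\mathbb E_1\to\mathbb E_2\circ(F^{op}\times F)$ such that $\mathfrak s_2(\Gamma_F(\eta))=F(\mathfrak s_1(\eta))$; it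 induces $\Gamma_F^n:\mathbb E_1^n\to\mathbb E_2^n\circ(F^{op}\times F)$ with $\Gamma_F^1=\Gamma_F$ and $\Gamma_F^{n+1}(x\otimes y)=\Gamma_F(x)\otimes\Gamma_F^n(y)$. A natural transformation $\alpha:F\to G$ of extriangulated functors is extriangulated if $\alpha_B\cdot\Gamma_F(\eta)=\Gamma_G(\eta)\cdot\alpha_A$ for all $\eta\in\mathbb E_1(A,B)$. The identity functors and $T$ are extriangulated via $\eta\mapsto\eta$ and $\eta\mapsto(\eta)_{i\in I}$, and composites are extriangulated via the composed transformations. The category $\mathcal C$ is AET4($I$) if all coproducts indexed by $I$ exist in $\mathcal C$ and, for the functor $S=\coprod_{i\in I}:\mathcal D\to\mathcal C$, there is a natural transformation $\Gamma:\mathbb F(-,T(?))\to\mathbb E(S(-),ST(?))$ such that, for every $\eta\in\mathbb F(D,TX)$, (i) $\mathfrak s(\Gamma(\eta))=S(\mathfrak t(\eta))$, and (ii) $\Gamma(\eta)\cdot\mu_i^{D}=\mu_i^{TX}\cdot\eta_i$ for all $i\in I$, where $\mu_i^{D}:D_i\to\coprod_{j}D_j$ are the canonical inclusions. It is AET4*($I$)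 if $\mathcal C^{op}$ is AET4($I$). (a) Let $\mathcal C$ be AET4($I$). Then $S$ admits a structure $\Gamma_S$ of extriangulated functor for which the unit $\varphi:1\to T\circ S$, $\varphi_D=(\mu_i^D)_{i\in I}$, is extriangulated. For each such $\Gamma_S$ and each $n\ge 1$, the canonical map $\mathbb F^n(D,TC)\to\prod_{i\in I}\mathbb E^n(D_i,C)$ is bijective for all $D\in\mathcal D$ and $C\in\mathcal C$, and, identifying the two groups, the maps $$\tau^n:\mathbb E^n\Big(\coprod_{i\in I}D_i,C\Big)\to\prod_{i\in I}\mathbb E^n(D_i,C),\quad \eta\mapsto(\eta\cdot\mu_i^D)_{i\in I},$$ $$\sigma^n:\prod_{i\in I}\mathbb E^n(D_i,C)\to\mathbb E^n\Big(\coprod_{i\in I}D_i,C\Big),\quad (\eta_i)_{i\in I}\mapsto\nabla_C\cdot\Gamma_S^n\big((\eta_i)_{i\in I}\big),$$ where $\nabla_C:C^{(I)}\to C$ is the codiagonal, are isomorphisms of abelian groups, natural in $D$ and $C$, and inverse to each other. (b) Let $\mathcal C$ be AET4*($I$). Then $P=\prod_{i\in I}:\mathcal D\to\mathcal C$ admits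 a structure $\Gamma_P$ of extriangulated functor for which the counit $T\circ P\to 1$, given by the canonical projections $\pi_i^D:\prod_jD_j\to D_i$, is extriangulated. For each such $\Gamma_P$ and each $n\ge 1$, the canonical map $\mathbb F^n(TC,D)\to\prod_{i\in I}\mathbb E^n(C,D_i)$ is bijective for all $D$ and $C$, and, identifying the two groups, the maps $$\mathbb E^n\Big(C,\prod_{i\in I}D_i\Big)\to\prod_{i\in I}\mathbb E^n(C,D_i),\quad \eta\mapsto(\pi_i^D\cdot\eta)_{i\in I},$$ $$\prod_{i\in I}\mathbb E^n(C,D_i)\to\mathbb E^n\Big(C,\prod_{i\in I}D_i\Big),\quad (\eta_i)_{i\in I}\mapsto\Gamma_P^n\big((\eta_i)_{i\in I}\big)\cdot\Delta_C,$$ where $\Delta_C:C\to C^I$ is the diagonal, are isomorphisms of abelian groups, natural in $C$ and $D$, and inverse to each other. -/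

import Mathlib

open CategoryTheory CategoryTheory.Limits Opposite

universe u v w t u₁ v₁ w₁ u₂ v₂ w₂ u₃ v₃ u₄ v₄

noncomputable section

namespace Extriangulated

/-! ### Additive bifunctors `Cᵒᵖ × C ⥤ Ab` -/

/-- An additive bifunctor `E : Cᵒᵖ × C ⥤ Ab`, given by the abelian groups `E(A, B)` and by the
two actions: `pull f x` is `x · f = E(f, B)(x)` and `push g x` is `g · x = E(A, g)(x)`. -/
structure AddBifunctor (C : Type u) [Category.{v} C] [Preadditive C] :
    Type (max u v (w + 1)) where
  /-- the group `E(A, B)`, contravariant in `A` and covariant in `B` -/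
  obj : C → C → Type w
  /-- the group structure on `E(A, B)` -/
  grp : ∀ A B : C, AddCommGroup (obj A B)
  /-- the contravariant action `x ↦ x · f` -/
  pull : ∀ {A' A B : C}, (A' ⟶ A) → (obj A B →+ obj A' B)
  /-- the covariant action `x ↦ g · x` -/
  push : ∀ {A B B' : C}, (B ⟶ B') → (obj A B →+ obj A B')
  pull_id : ∀ {A B : C} (x : obj A B), pull (𝟙 A) x = x
  pull_comp : ∀ {A'' A' A B : C} (f : A'' ⟶ A') (g : A' ⟶ A) (x : obj A B),
    pull (f ≫ g) x = pull f (pull g x)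
  push_id : ∀ {A B : C} (x : obj A B), push (𝟙 B) x = x
  push_comp : ∀ {A B B' B'' : C} (f : B ⟶ B') (g : B' ⟶ B'') (x : obj A B),
    push (f ≫ g) x = push g (push f x)
  push_pull : ∀ {A' A B B' : C} (f : A' ⟶ A) (g : B ⟶ B') (x : obj A B),
    push g (pull f x) = pull f (push g x)
  pull_add : ∀ {A' A B : C} (f g : A' ⟶ A) (x : obj A B),
    pull (f + g) x = pull f x + pull g x
  push_add : ∀ {A B B' : C} (f g : B ⟶ B') (x : obj A B),
    push (f + g) x = push f x + push g x

attribute [instance] AddBifunctor.grp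

section Bifunctors

variable {C : Type u} [Category.{v} C] [Preadditive C]
variable {D : Type u₁} [Category.{v₁} D] [Preadditive D]

/-- The same bifunctor with values in a larger universe. -/
def AddBifunctor.lift (E : AddBifunctor.{u, v, w} C) : AddBifunctor.{u, v, max u w} C where
  obj A B := ULift.{u} (E.obj A B)
  grp _ _ := inferInstance
  pull f := AddEquiv.ulift.symm.toAddMonoidHom.comp
    ((E.pull f).comp AddEquiv.ulift.toAddMonoidHom)
  push f := AddEquiv.ulift.symm.toAddMonoidHom.comp
    ((E.push f).comp AddEquiv.ulift.toAddMonoidHom)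
  pull_id x := congrArg ULift.up (E.pull_id x.down)
  pull_comp f g x := congrArg ULift.up (E.pull_comp f g x.down)
  push_id x := congrArg ULift.up (E.push_id x.down)
  push_comp f g x := congrArg ULift.up (E.push_comp f g x.down)
  push_pull f g x := congrArg ULift.up (E.push_pull f g x.down)
  pull_add f g x := congrArg ULift.up (E.pull_add f g x.down)
  push_add f g x := congrArg ULift.up (E.push_add f g x.down)

/-- The generators `x ⊗ y` of `(E ◇ G)(A, B)`: an object `M`, an `x ∈ E(M, B)` and a
`y ∈ G(A, M)`. -/
abbrev DiamondGen (E : AddBifunctor.{u, v, w} C) (G : AddBifunctor.{u, v, w₁} C) (A B : C) :=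
  Σ M : C, E.obj M B × G.obj A M

/-- The relations of the coend `∫^M E(M, B) ⊗ G(A, M)`: `x ⊗ y` is additive in `x` and in `y`, and
`(x · f) ⊗ y = x ⊗ (f · y)`. -/
inductive DiamondRel (E : AddBifunctor.{u, v, w} C) (G : AddBifunctor.{u, v, w₁} C) (A B : C) :
    FreeAbelianGroup (DiamondGen E G A B) → Prop
  | add_left {M : C} (x x' : E.obj M B) (y : G.obj A M) : DiamondRel E G A B
      (.of ⟨M, x + x', y⟩ - (.of ⟨M, x, y⟩ + .of ⟨M, x', y⟩))
  | add_right {M : C} (x : E.obj M B) (y y' : G.obj A M) : DiamondRel E G A B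
      (.of ⟨M, x, y + y'⟩ - (.of ⟨M, x, y⟩ + .of ⟨M, x, y'⟩))
  | balance {M' M : C} (f : M' ⟶ M) (x : E.obj M B) (y : G.obj A M') : DiamondRel E G A B
      (.of ⟨M', E.pull f x, y⟩ - .of ⟨M, x, G.push f y⟩)

/-- The group `(E ◇ G)(A, B) = ∫^M E(M, B) ⊗ G(A, M)`. -/
abbrev Diamond (E : AddBifunctor.{u, v, w} C) (G : AddBifunctor.{u, v, w₁} C) (A B : C) :=
  FreeAbelianGroup (DiamondGen E G A B) ⧸ AddSubgroup.closure {z | DiamondRel E G A B z}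

namespace Diamond

variable {E : AddBifunctor.{u, v, w} C} {G : AddBifunctor.{u, v, w₁} C}

/-- The class of `x ⊗ y`. -/
def mk {A B M : C} (x : E.obj M B) (y : G.obj A M) : Diamond E G A B :=
  QuotientAddGroup.mk (FreeAbelianGroup.of ⟨M, x, y⟩)

lemma mk_add_left {A B M : C} (x x' : E.obj M B) (y : G.obj A M) :
    mk (x + x') y = mk x y + mk x' y := by
  rw [← sub_eq_zero]
  exact (QuotientAddGroup.eq_zero_iff _).2 (AddSubgroup.subset_closure (.add_left x x' y))

lemma mk_add_right {A B M : C} (x : E.obj M B) (y y' : G.obj A M) :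
    mk x (y + y') = mk x y + mk x y' := by
  rw [← sub_eq_zero]
  exact (QuotientAddGroup.eq_zero_iff _).2 (AddSubgroup.subset_closure (.add_right x y y'))

lemma mk_balance {A B M' M : C} (f : M' ⟶ M) (x : E.obj M B) (y : G.obj A M') :
    mk (E.pull f x) y = mk x (G.push f y) := by
  rw [← sub_eq_zero]
  exact (QuotientAddGroup.eq_zero_iff _).2 (AddSubgroup.subset_closure (.balance f x y))

/-- The universal property of `(E ◇ G)(A, B)`. -/
def lift {A B : C} {H : Type*} [AddCommGroup H] (φ : ∀ M : C, E.obj M B → G.obj A M → H)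
    (h₁ : ∀ (M : C) (x x' : E.obj M B) (y : G.obj A M), φ M (x + x') y = φ M x y + φ M x' y)
    (h₂ : ∀ (M : C) (x : E.obj M B) (y y' : G.obj A M), φ M x (y + y') = φ M x y + φ M x y')
    (h₃ : ∀ (M' M : C) (f : M' ⟶ M) (x : E.obj M B) (y : G.obj A M'),
      φ M' (E.pull f x) y = φ M x (G.push f y)) :
    Diamond E G A B →+ H :=
  QuotientAddGroup.lift _ (FreeAbelianGroup.lift fun p => φ p.1 p.2.1 p.2.2) (by
    rw [AddSubgroup.closure_le]
    rintro z (⟨x, x', y⟩ | ⟨x, y, y'⟩ | ⟨f, x, y⟩)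
    · simp [h₁]
    · simp [h₂]
    · simp [h₃])

@[simp]
lemma lift_mk {A B : C} {H : Type*} [AddCommGroup H] (φ : ∀ M : C, E.obj M B → G.obj A M → H)
    (h₁ h₂ h₃) {M : C} (x : E.obj M B) (y : G.obj A M) :
    lift φ h₁ h₂ h₃ (mk x y) = φ M x y := by
  unfold lift mk
  rw [QuotientAddGroup.lift_mk, FreeAbelianGroup.lift_apply_of]

lemma hom_ext {A B : C} {H : Type*} [AddCommGroup H] {φ ψ : Diamond E G A B →+ H}
    (h : ∀ (M : C) (x : E.obj M B) (y : G.obj A M), φ (mk x y) = ψ (mk x y)) : φ = ψ :=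
  QuotientAddGroup.addMonoidHom_ext _
    (FreeAbelianGroup.lift_ext _ _ fun p => h p.1 p.2.1 p.2.2)

lemma hom_congr {A B : C} {H : Type*} [AddCommGroup H] {φ ψ : Diamond E G A B →+ H}
    (h : ∀ (M : C) (x : E.obj M B) (y : G.obj A M), φ (mk x y) = ψ (mk x y))
    (z : Diamond E G A B) : φ z = ψ z :=
  DFunLike.congr_fun (hom_ext h) z

/-- `(x ⊗ y) · f = x ⊗ (y · f)`. -/
def pull {A' A B : C} (f : A' ⟶ A) : Diamond E G A B →+ Diamond E G A' B :=
  lift (fun _ x y => mk x (G.pull f y))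
    (fun _ x x' y => mk_add_left x x' _)
    (fun _ x y y' => by simp only [map_add, mk_add_right])
    (fun _ _ g x y => by simp only [mk_balance, G.push_pull])

/-- `g · (x ⊗ y) = (g · x) ⊗ y`. -/
def push {A B B' : C} (g : B ⟶ B') : Diamond E G A B →+ Diamond E G A B' :=
  lift (fun _ x y => mk (E.push g x) y)
    (fun _ x x' y => by simp only [map_add, mk_add_left])
    (fun _ x y y' => mk_add_right _ y y')
    (fun _ _ f x y => by simp only [E.push_pull, mk_balance])

@[simp]
lemma pull_mk {A' A B M : C} (f : A' ⟶ A) (x : E.obj M B) (y : G.obj A M) :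
    pull f (mk x y) = mk x (G.pull f y) := lift_mk _ _ _ _ _ _

@[simp]
lemma push_mk {A B B' M : C} (g : B ⟶ B') (x : E.obj M B) (y : G.obj A M) :
    push g (mk x y) = mk (E.push g x) y := lift_mk _ _ _ _ _ _

end Diamond

/-- The additive bifunctor `E ◇ G = ∫^M E(M, ?) ⊗ G(-, M)`. -/
def AddBifunctor.diamond (E : AddBifunctor.{u, v, w} C) (G : AddBifunctor.{u, v, w₁} C) :
    AddBifunctor.{u, v, max u w w₁} C where
  obj A B := Diamond E G A B
  grp _ _ := inferInstance
  pull f := Diamond.pull f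
  push g := Diamond.push g
  pull_id x := Diamond.hom_congr (φ := Diamond.pull (𝟙 _)) (ψ := AddMonoidHom.id _)
    (fun _ x y => by simp [G.pull_id]) x
  pull_comp f g x := Diamond.hom_congr (φ := Diamond.pull (f ≫ g))
    (ψ := (Diamond.pull f).comp (Diamond.pull g)) (fun _ x y => by simp [G.pull_comp]) x
  push_id x := Diamond.hom_congr (φ := Diamond.push (𝟙 _)) (ψ := AddMonoidHom.id _)
    (fun _ x y => by simp [E.push_id]) x
  push_comp f g x := Diamond.hom_congr (φ := Diamond.push (f ≫ g))
    (ψ := (Diamond.push g).comp (Diamond.push f)) (fun _ x y => by simp [E.push_comp]) x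
  push_pull f g x := Diamond.hom_congr (φ := (Diamond.push g).comp (Diamond.pull f))
    (ψ := (Diamond.pull f).comp (Diamond.push g)) (fun _ x y => by simp) x
  pull_add f g x := Diamond.hom_congr (φ := Diamond.pull (f + g))
    (ψ := Diamond.pull f + Diamond.pull g)
    (fun _ x y => by simp [G.pull_add, Diamond.mk_add_right]) x
  push_add f g x := Diamond.hom_congr (φ := Diamond.push (f + g))
    (ψ := Diamond.push f + Diamond.push g)
    (fun _ x y => by simp [E.push_add, Diamond.mk_add_left]) x

/-- The higher extension bifunctors: `E.higher n` is `𝔼ⁿ⁺¹`, that is, `𝔼¹ = 𝔼` and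
`𝔼ⁿ⁺² = 𝔼 ◇ 𝔼ⁿ⁺¹`. -/
def AddBifunctor.higher (E : AddBifunctor.{u, v, w} C) : ℕ → AddBifunctor.{u, v, max u w} C
  | 0 => E.lift
  | n + 1 => E.diamond (E.higher n)

/-- A natural transformation `E ⟶ E' ∘ (Fᵒᵖ × F)` of bifunctors with values in abelian groups. -/
structure BifunctorHom (E : AddBifunctor.{u, v, w} C) (E' : AddBifunctor.{u₁, v₁, w₁} D)
    (F : C ⥤ D) where
  /-- the components -/
  app : ∀ A B : C, E.obj A B →+ E'.obj (F.obj A) (F.obj B)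
  app_pull : ∀ {A' A B : C} (f : A' ⟶ A) (x : E.obj A B),
    app A' B (E.pull f x) = E'.pull (F.map f) (app A B x)
  app_push : ∀ {A B B' : C} (g : B ⟶ B') (x : E.obj A B),
    app A B' (E.push g x) = E'.push (F.map g) (app A B x)

/-- The same transformation after enlarging the universe. -/
def BifunctorHom.lift {E : AddBifunctor.{u, v, w} C} {E' : AddBifunctor.{u₁, v₁, w₁} D}
    {F : C ⥤ D} (Γ : BifunctorHom E E' F) : BifunctorHom E.lift E'.lift F where
  app A B := AddEquiv.ulift.symm.toAddMonoidHom.comp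
    ((Γ.app A B).comp AddEquiv.ulift.toAddMonoidHom)
  app_pull f x := congrArg ULift.up (Γ.app_pull f x.down)
  app_push g x := congrArg ULift.up (Γ.app_push g x.down)

/-- `x ⊗ y ↦ Γ(x) ⊗ Γ'(y)`. -/
def Diamond.map {E : AddBifunctor.{u, v, w} C} {G : AddBifunctor.{u, v, w₂} C}
    {E' : AddBifunctor.{u₁, v₁, w₁} D} {G' : AddBifunctor.{u₁, v₁, u₂} D}
    {F : C ⥤ D} (Γ : BifunctorHom E E' F) (Γ' : BifunctorHom G G' F) (A B : C) :
    Diamond E G A B →+ Diamond E' G' (F.obj A) (F.obj B) :=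
  Diamond.lift (fun M x y => Diamond.mk (Γ.app M B x) (Γ'.app A M y))
    (fun _ x x' y => by simp only [map_add, Diamond.mk_add_left])
    (fun _ x y y' => by simp only [map_add, Diamond.mk_add_right])
    (fun _ _ f x y => by simp only [Γ.app_pull, Γ'.app_push, Diamond.mk_balance])

@[simp]
lemma Diamond.map_mk {E : AddBifunctor.{u, v, w} C} {G : AddBifunctor.{u, v, w₂} C}
    {E' : AddBifunctor.{u₁, v₁, w₁} D} {G' : AddBifunctor.{u₁, v₁, u₂} D}
    {F : C ⥤ D} (Γ : BifunctorHom E E' F) (Γ' : BifunctorHom G G' F) {A B M : C}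
    (x : E.obj M B) (y : G.obj A M) :
    Diamond.map Γ Γ' A B (Diamond.mk x y) = Diamond.mk (Γ.app M B x) (Γ'.app A M y) :=
  Diamond.lift_mk _ _ _ _ _ _

/-- The transformation `E ◇ G ⟶ (E' ◇ G') ∘ (Fᵒᵖ × F)` given by `x ⊗ y ↦ Γ(x) ⊗ Γ'(y)`. -/
def BifunctorHom.diamond {E : AddBifunctor.{u, v, w} C} {G : AddBifunctor.{u, v, w₂} C}
    {E' : AddBifunctor.{u₁, v₁, w₁} D} {G' : AddBifunctor.{u₁, v₁, u₂} D}
    {F : C ⥤ D} (Γ : BifunctorHom E E' F) (Γ' : BifunctorHom G G' F) :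
    BifunctorHom (E.diamond G) (E'.diamond G') F where
  app A B := Diamond.map Γ Γ' A B
  app_pull f x := Diamond.hom_congr
    (φ := (Diamond.map Γ Γ' _ _).comp (Diamond.pull f))
    (ψ := (Diamond.pull (F.map f)).comp (Diamond.map Γ Γ' _ _))
    (fun _ x y => by simp [Γ'.app_pull]) x
  app_push g x := Diamond.hom_congr
    (φ := (Diamond.map Γ Γ' _ _).comp (Diamond.push g))
    (ψ := (Diamond.push (F.map g)).comp (Diamond.map Γ Γ' _ _))
    (fun _ x y => by simp [Γ.app_push]) x

/-- The transformations induced on higher extensions: `Γ.higher n` is `Γⁿ⁺¹`, where `Γ¹ = Γ` and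
`Γⁿ⁺²(x ⊗ y) = Γ(x) ⊗ Γⁿ⁺¹(y)`. -/
def BifunctorHom.higher {E : AddBifunctor.{u, v, w} C} {E' : AddBifunctor.{u₁, v₁, w₁} D}
    {F : C ⥤ D} (Γ : BifunctorHom E E' F) :
    ∀ n : ℕ, BifunctorHom (E.higher n) (E'.higher n) F
  | 0 => Γ.lift
  | n + 1 => Γ.diamond (Γ.higher n)

end Bifunctors

/-! ### Extriangulated categories -/

/-- A pair `(𝔼, 𝔰)` on `C`: an additive bifunctor `𝔼` and a correspondence `𝔰` that sends each
`δ ∈ 𝔼(A, B)` to an equivalence class of sequences `B ⟶ M ⟶ A`. Here `Realizes δ f g` says that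
`𝔰(δ)` is the class of `B --f--> M --g--> A`. -/
structure ExtData (C : Type u) [Category.{v} C] [Preadditive C] :
    Type (max u v (w + 1)) extends AddBifunctor.{u, v, w} C where
  /-- `𝔰(δ) = [B --f--> M --g--> A]` -/
  Realizes : ∀ {A B M : C}, obj A B → (B ⟶ M) → (M ⟶ A) → Prop
  exists_realizes : ∀ {A B : C} (δ : obj A B),
    ∃ (M : C) (f : B ⟶ M) (g : M ⟶ A), Realizes δ f g
  realizes_iff : ∀ {A B M M' : C} {δ : obj A B} {f : B ⟶ M} {g : M ⟶ A}, Realizes δ f g →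
    ∀ (f' : B ⟶ M') (g' : M' ⟶ A),
      Realizes δ f' g' ↔ ∃ e : M ≅ M', f ≫ e.hom = f' ∧ e.hom ≫ g' = g

section Extri

variable {C : Type u} [Category.{v} C] [Preadditive C]
variable {D : Type u₁} [Category.{v₁} D] [Preadditive D]

/-- The pair `(𝔼, 𝔰)` makes the additive category `C` an extriangulated category. -/
structure ExtData.IsExtriangulated [HasZeroObject C] [HasBinaryBiproducts C] (E : ExtData.{u, v, w} C) : Prop where
  /-- `𝔰` is a realization: morphisms of extensions lift to morphisms of sequences -/
  realization : ∀ {A B M A' B' M' : C} {δ : E.obj A B} {δ' : E.obj A' B'}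
    {x : B ⟶ M} {y : M ⟶ A} {x' : B' ⟶ M'} {y' : M' ⟶ A'},
    E.Realizes δ x y → E.Realizes δ' x' y' →
    ∀ (a : B ⟶ B') (c : A ⟶ A'), E.push a δ = E.pull c δ' →
      ∃ b : M ⟶ M', x ≫ b = a ≫ x' ∧ y ≫ c = b ≫ y'
  /-- the zero extension is realized by the split sequence -/
  realizes_zero : ∀ A B : C, E.Realizes (0 : E.obj A B) (biprod.inl : B ⟶ B ⊞ A) biprod.snd
  /-- `𝔰(δ ⊕ δ') = 𝔰(δ) ⊕ 𝔰(δ')` -/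
  realizes_sum : ∀ {A B M A' B' M' : C} {δ : E.obj A B} {δ' : E.obj A' B'}
    {x : B ⟶ M} {y : M ⟶ A} {x' : B' ⟶ M'} {y' : M' ⟶ A'},
    E.Realizes δ x y → E.Realizes δ' x' y' →
    E.Realizes
      (E.push (biprod.inl : B ⟶ B ⊞ B') (E.pull (biprod.fst : A ⊞ A' ⟶ A) δ) +
        E.push (biprod.inr : B' ⟶ B ⊞ B') (E.pull (biprod.snd : A ⊞ A' ⟶ A') δ'))
      (biprod.map x x') (biprod.map y y')
  /-- (ET3) -/
  et3 : ∀ {A B M A' B' M' : C} {δ : E.obj A B} {δ' : E.obj A' B'}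
    {x : B ⟶ M} {y : M ⟶ A} {x' : B' ⟶ M'} {y' : M' ⟶ A'},
    E.Realizes δ x y → E.Realizes δ' x' y' →
    ∀ (a : B ⟶ B') (b : M ⟶ M'), x ≫ b = a ≫ x' →
      ∃ c : A ⟶ A', E.push a δ = E.pull c δ' ∧ y ≫ c = b ≫ y'
  /-- (ET3)ᵒᵖ -/
  et3_op : ∀ {A B M A' B' M' : C} {δ : E.obj A B} {δ' : E.obj A' B'}
    {x : B ⟶ M} {y : M ⟶ A} {x' : B' ⟶ M'} {y' : M' ⟶ A'},
    E.Realizes δ x y → E.Realizes δ' x' y' →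
    ∀ (b : M ⟶ M') (c : A ⟶ A'), y ≫ c = b ≫ y' →
      ∃ a : B ⟶ B', E.push a δ = E.pull c δ' ∧ x ≫ b = a ≫ x'
  /-- (ET4) -/
  et4 : ∀ {X Y Z W V : C} {δ : E.obj W X} {δ' : E.obj V Y}
    {f : X ⟶ Y} {f' : Y ⟶ W} {g : Y ⟶ Z} {g' : Z ⟶ V},
    E.Realizes δ f f' → E.Realizes δ' g g' →
    ∃ (U : C) (h' : Z ⟶ U) (d : W ⟶ U) (e : U ⟶ V) (δ'' : E.obj U X),
      g ≫ h' = f' ≫ d ∧ h' ≫ e = g' ∧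
      E.Realizes δ'' (f ≫ g) h' ∧
      E.Realizes (E.push f' δ') d e ∧
      E.pull d δ'' = δ ∧
      E.push f δ'' = E.pull e δ'
  /-- (ET4)ᵒᵖ -/
  et4_op : ∀ {X Y Z W V : C} {δ : E.obj Y W} {δ' : E.obj Z V}
    {f' : W ⟶ X} {f : X ⟶ Y} {g' : V ⟶ Y} {g : Y ⟶ Z},
    E.Realizes δ f' f → E.Realizes δ' g' g →
    ∃ (U : C) (h' : U ⟶ X) (d : W ⟶ U) (e : U ⟶ V) (δ'' : E.obj Z U),
      h' ≫ f = e ≫ g' ∧ d ≫ h' = f' ∧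
      E.Realizes δ'' h' (f ≫ g) ∧
      E.Realizes (E.pull g' δ) d e ∧
      E.push e δ'' = δ' ∧
      E.push d δ = E.pull g δ''

/-- The opposite pair on `Cᵒᵖ`: `𝔼ᵒᵖ(A, B) = 𝔼(B, A)`, and `δ` is realized by the reversed
sequence. -/
def ExtData.op (E : ExtData.{u, v, w} C) : ExtData.{u, v, w} Cᵒᵖ where
  obj A B := E.obj B.unop A.unop
  grp _ _ := inferInstance
  pull f := E.push f.unop
  push g := E.pull g.unop
  pull_id x := E.push_id x
  pull_comp f g x := E.push_comp g.unop f.unop x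
  push_id x := E.pull_id x
  push_comp f g x := E.pull_comp g.unop f.unop x
  push_pull f g x := (E.push_pull g.unop f.unop x).symm
  pull_add f g x := E.push_add f.unop g.unop x
  push_add f g x := E.pull_add f.unop g.unop x
  Realizes δ f g := E.Realizes δ g.unop f.unop
  exists_realizes δ := by
    obtain ⟨M, f, g, h⟩ := E.exists_realizes δ
    exact ⟨Opposite.op M, g.op, f.op, h⟩
  realizes_iff {A B M M' δ f g} h f' g' := by
    rw [E.realizes_iff h g'.unop f'.unop]
    constructor
    · rintro ⟨e, h₁, h₂⟩
      refine ⟨e.symm.op, ?_, ?_⟩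
      · apply Quiver.Hom.unop_inj
        change e.inv ≫ f.unop = f'.unop
        rw [← h₂, Iso.inv_hom_id_assoc]
      · apply Quiver.Hom.unop_inj
        change g'.unop ≫ e.inv = g.unop
        rw [← h₁, Category.assoc, Iso.hom_inv_id, Category.comp_id]
    · rintro ⟨e, h₁, h₂⟩
      refine ⟨e.symm.unop, ?_, ?_⟩
      · change g.unop ≫ e.inv.unop = g'.unop
        rw [← unop_comp, ← h₂, Iso.inv_hom_id_assoc]
      · change e.inv.unop ≫ f'.unop = f.unop
        rw [← unop_comp, ← h₁, Category.assoc, Iso.hom_inv_id, Category.comp_id]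

/-! ### The product category `Fun(I, C)` -/

/-- The product category is preadditive componentwise. -/
instance piPreadditive (I : Type t) : Preadditive (I → C) where
  homGroup X Y := inferInstanceAs (AddCommGroup (∀ i, X i ⟶ Y i))
  add_comp _ _ _ f f' g := funext fun i => Preadditive.add_comp _ _ _ (f i) (f' i) (g i)
  comp_add _ _ _ f g g' := funext fun i => Preadditive.comp_add _ _ _ (f i) (g i) (g' i)

/-- The pair `(𝔽, 𝔱)` on the product category: `𝔽(X, Y) = ∏ i, 𝔼(X i, Y i)` and `𝔱 = ∏ 𝔰`. -/
def ExtData.pi (E : ExtData.{u, v, w} C) (I : Type t) :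
    ExtData.{max t u, max t v, max t w} (I → C) where
  obj X Y := ∀ i, E.obj (X i) (Y i)
  grp _ _ := inferInstance
  pull f := AddMonoidHom.pi fun i => (E.pull (f i)).comp (Pi.evalAddMonoidHom _ i)
  push g := AddMonoidHom.pi fun i => (E.push (g i)).comp (Pi.evalAddMonoidHom _ i)
  pull_id x := funext fun i => E.pull_id (x i)
  pull_comp f g x := funext fun i => E.pull_comp (f i) (g i) (x i)
  push_id x := funext fun i => E.push_id (x i)
  push_comp f g x := funext fun i => E.push_comp (f i) (g i) (x i)
  push_pull f g x := funext fun i => E.push_pull (f i) (g i) (x i)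
  pull_add f g x := funext fun i => E.pull_add (f i) (g i) (x i)
  push_add f g x := funext fun i => E.push_add (f i) (g i) (x i)
  Realizes δ f g := ∀ i, E.Realizes (δ i) (f i) (g i)
  exists_realizes δ := by
    choose M f g h using fun i => E.exists_realizes (δ i)
    exact ⟨M, f, g, h⟩
  realizes_iff {A B M M' δ f g} h f' g' := by
    constructor
    · intro h'
      choose e h₁ h₂ using fun i => (E.realizes_iff (h i) (f' i) (g' i)).1 (h' i)
      exact ⟨Pi.isoMk e, funext h₁, funext h₂⟩
    · rintro ⟨e, h₁, h₂⟩ i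
      exact (E.realizes_iff (h i) (f' i) (g' i)).2
        ⟨Pi.isoApp e i, congrFun h₁ i, congrFun h₂ i⟩

variable (C) in
/-- The constant functor `T : C ⥤ Fun(I, C)`. -/
def constFunctor (I : Type t) : C ⥤ (I → C) where
  obj X _ := X
  map f _ := f

variable (C) in
/-- The coproduct functor `S : Fun(I, C) ⥤ C`. -/
def coprodFunctor (I : Type t) [HasCoproductsOfShape I C] : (I → C) ⥤ C where
  obj X := ∐ X
  map {X Y} f := Limits.Sigma.map (f := X) (g := Y) f
  map_id X := Limits.Sigma.map_id (f := X)
  map_comp {X Y Z} f g := (Limits.Sigma.map_comp_map (f := X) (g := Y) (h := Z) f g).symm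

variable (C) in
/-- The product functor `P : Fun(I, C) ⥤ C`. -/
def prodFunctor (I : Type t) [HasProductsOfShape I C] : (I → C) ⥤ C where
  obj X := ∏ᶜ X
  map {X Y} f := Limits.Pi.map (f := X) (g := Y) f
  map_id X := Limits.Pi.map_id (f := X)
  map_comp {X Y Z} f g := (Limits.Pi.map_comp_map (f := X) (g := Y) (h := Z) f g).symm

variable (C) in
/-- The unit `φ : 1 ⟶ T ∘ S`, given by the canonical inclusions `μ i : D i ⟶ ∐ D`. -/
def coprodUnit (I : Type t) [HasCoproductsOfShape I C] :
    𝟭 (I → C) ⟶ coprodFunctor C I ⋙ constFunctor C I where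
  app D := fun i => Limits.Sigma.ι D i
  naturality X Y f := funext fun i => (Limits.Sigma.ι_map (f := X) (g := Y) f i).symm

variable (C) in
/-- The counit `T ∘ P ⟶ 1`, given by the canonical projections `π i : ∏ D ⟶ D i`. -/
def prodCounit (I : Type t) [HasProductsOfShape I C] :
    prodFunctor C I ⋙ constFunctor C I ⟶ 𝟭 (I → C) where
  app D := fun i => Limits.Pi.π D i
  naturality X Y f := funext fun i => Limits.Pi.map_π (f := X) (g := Y) f i

/-- The codiagonal `∇ : X^(I) ⟶ X`. -/
def codiagonal (I : Type t) [HasCoproductsOfShape I C] (X : C) :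
    (coprodFunctor C I).obj ((constFunctor C I).obj X) ⟶ X :=
  Limits.Sigma.desc fun _ => 𝟙 X

/-- The diagonal `Δ : X ⟶ X^I`. -/
def diagonal (I : Type t) [HasProductsOfShape I C] (X : C) :
    X ⟶ (prodFunctor C I).obj ((constFunctor C I).obj X) :=
  Limits.Pi.lift fun _ => 𝟙 X

/-- The canonical transformation `𝔽(X, Y) ⟶ 𝔼(X i, Y i)` along the evaluation functor. -/
def evalHom (E : ExtData.{u, v, w} C) (I : Type t) (i : I) :
    BifunctorHom (E.pi I).toAddBifunctor E.toAddBifunctor (Pi.eval (fun _ : I => C) i) where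
  app X Y := Pi.evalAddMonoidHom (fun i => E.obj (X i) (Y i)) i
  app_pull _ _ := rfl
  app_push _ _ := rfl

/-- The canonical map `𝔽ⁿ⁺¹(X, Y) ⟶ ∏ i, 𝔼ⁿ⁺¹(X i, Y i)`, which sends a higher extension of the
product category to the family of its components. -/
def components (E : ExtData.{u, v, w} C) (I : Type t) (n : ℕ) (X Y : I → C) :
    ((E.pi I).higher n).obj X Y →+ ∀ i, (E.higher n).obj (X i) (Y i) :=
  AddMonoidHom.pi fun i => ((evalHom E I i).higher n).app X Y

/-! ### Extriangulated functors -/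

section Functors

variable {L : Type u₂} [Category.{v₂} L] [Preadditive L]
variable {X₁ : Type u₃} [Category.{v₃} X₁] {X₂ : Type u₄} [Category.{v₄} X₂]

/-- The structure of an extriangulated functor on `F : C ⥤ D`: `F` is additive, and there is a
natural transformation `Γ : 𝔼 ⟶ 𝔼' ∘ (Fᵒᵖ × F)` with `𝔰'(Γ(δ)) = F(𝔰(δ))`. -/
structure ExtFunctor (E : ExtData.{u, v, w} C) (E' : ExtData.{u₁, v₁, w₁} D) (F : C ⥤ D)
    extends BifunctorHom E.toAddBifunctor E'.toAddBifunctor F where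
  additive : F.Additive
  realizes : ∀ {A B M : C} {δ : E.obj A B} {f : B ⟶ M} {g : M ⟶ A},
    E.Realizes δ f g → E'.Realizes (app A B δ) (F.map f) (F.map g)

/-- The structure of an `(S₁, S₂)`-extriangulated functor on `F`: `F` is additive, and there is a
natural transformation `Γ : 𝔼(S₁ -, S₂ ?) ⟶ 𝔼'(F S₁ -, F S₂ ?)` with `𝔰'(Γ(δ)) = F(𝔰(δ))`. -/
structure ExtFunctorAlong (E : ExtData.{u, v, w} C) (E' : ExtData.{u₁, v₁, w₁} D) (F : C ⥤ D)
    (S₁ : X₁ ⥤ C) (S₂ : X₂ ⥤ C) where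
  additive : F.Additive
  /-- the components of `Γ` -/
  app : ∀ (X : X₁) (Y : X₂), E.obj (S₁.obj X) (S₂.obj Y) →+
    E'.obj (F.obj (S₁.obj X)) (F.obj (S₂.obj Y))
  app_pull : ∀ {X' X : X₁} {Y : X₂} (f : X' ⟶ X) (δ : E.obj (S₁.obj X) (S₂.obj Y)),
    app X' Y (E.pull (S₁.map f) δ) = E'.pull (F.map (S₁.map f)) (app X Y δ)
  app_push : ∀ {X : X₁} {Y Y' : X₂} (g : Y ⟶ Y') (δ : E.obj (S₁.obj X) (S₂.obj Y)),
    app X Y' (E.push (S₂.map g) δ) = E'.push (F.map (S₂.map g)) (app X Y δ)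
  realizes : ∀ {X : X₁} {Y : X₂} {M : C} {δ : E.obj (S₁.obj X) (S₂.obj Y)}
    {f : S₂.obj Y ⟶ M} {g : M ⟶ S₁.obj X},
    E.Realizes δ f g → E'.Realizes (app X Y δ) (F.map f) (F.map g)

/-- The identity functor is extriangulated. -/
def ExtFunctor.id (E : ExtData.{u, v, w} C) : ExtFunctor E E (𝟭 C) where
  app A B := AddMonoidHom.id (E.obj A B)
  app_pull _ _ := rfl
  app_push _ _ := rfl
  additive := inferInstance
  realizes h := h

/-- The composition of extriangulated functors. -/
def ExtFunctor.comp {E : ExtData.{u, v, w} C} {E' : ExtData.{u₁, v₁, w₁} D}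
    {E'' : ExtData.{u₂, v₂, w₂} L} {F : C ⥤ D} {G : D ⥤ L}
    (Γ : ExtFunctor E E' F) (Γ' : ExtFunctor E' E'' G) : ExtFunctor E E'' (F ⋙ G) where
  app A B := (Γ'.app (F.obj A) (F.obj B)).comp (Γ.app A B)
  app_pull f x := (congrArg (Γ'.app _ _) (Γ.app_pull f x)).trans (Γ'.app_pull (F.map f) _)
  app_push g x := (congrArg (Γ'.app _ _) (Γ.app_push g x)).trans (Γ'.app_push (F.map g) _)
  additive :=
    haveI := Γ.additive
    haveI := Γ'.additive
    inferInstance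
  realizes h := Γ'.realizes (Γ.realizes h)

/-- An extriangulated functor is `(S₁, S₂)`-extriangulated for all `S₁` and `S₂`. -/
def ExtFunctor.along {E : ExtData.{u, v, w} C} {E' : ExtData.{u₁, v₁, w₁} D} {F : C ⥤ D}
    (Γ : ExtFunctor E E' F) (S₁ : X₁ ⥤ C) (S₂ : X₂ ⥤ C) : ExtFunctorAlong E E' F S₁ S₂ where
  additive := Γ.additive
  app X Y := Γ.app (S₁.obj X) (S₂.obj Y)
  app_pull f δ := Γ.app_pull (S₁.map f) δ
  app_push g δ := Γ.app_push (S₂.map g) δ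
  realizes h := Γ.realizes h

/-- The composition of an `(S₁, S₂)`-extriangulated functor with an extriangulated functor. -/
def ExtFunctorAlong.comp {E : ExtData.{u, v, w} C} {E' : ExtData.{u₁, v₁, w₁} D}
    {E'' : ExtData.{u₂, v₂, w₂} L} {F : C ⥤ D} {G : D ⥤ L} {S₁ : X₁ ⥤ C} {S₂ : X₂ ⥤ C}
    (Γ : ExtFunctorAlong E E' F S₁ S₂) (Γ' : ExtFunctor E' E'' G) :
    ExtFunctorAlong E E'' (F ⋙ G) S₁ S₂ where
  additive :=
    haveI := Γ.additive
    haveI := Γ'.additive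
    inferInstance
  app X Y := (Γ'.app (F.obj (S₁.obj X)) (F.obj (S₂.obj Y))).comp (Γ.app X Y)
  app_pull f δ := (congrArg (Γ'.app _ _) (Γ.app_pull f δ)).trans (Γ'.app_pull _ _)
  app_push g δ := (congrArg (Γ'.app _ _) (Γ.app_push g δ)).trans (Γ'.app_push _ _)
  realizes h := Γ'.realizes (Γ.realizes h)

/-- `α : F ⟶ G` is a natural transformation of extriangulated functors. -/
def IsExtNat {E : ExtData.{u, v, w} C} {E' : ExtData.{u₁, v₁, w₁} D} {F G : C ⥤ D}
    (Γ : ExtFunctor E E' F) (Γ' : ExtFunctor E E' G) (α : F ⟶ G) : Prop :=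
  ∀ (A B : C) (δ : E.obj A B),
    E'.push (α.app B) (Γ.app A B δ) = E'.pull (α.app A) (Γ'.app A B δ)

/-- `α : F ⟶ G` is a natural transformation of `(S₁, S₂)`-extriangulated functors. -/
def IsExtNatAlong {E : ExtData.{u, v, w} C} {E' : ExtData.{u₁, v₁, w₁} D} {F G : C ⥤ D}
    {S₁ : X₁ ⥤ C} {S₂ : X₂ ⥤ C} (Γ : ExtFunctorAlong E E' F S₁ S₂)
    (Γ' : ExtFunctorAlong E E' G S₁ S₂) (α : F ⟶ G) : Prop :=
  ∀ (X : X₁) (Y : X₂) (δ : E.obj (S₁.obj X) (S₂.obj Y)),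
    E'.push (α.app (S₂.obj Y)) (Γ.app X Y δ) = E'.pull (α.app (S₁.obj X)) (Γ'.app X Y δ)

end Functors

/-- The constant functor `T` is extriangulated via `Γ_T(δ) = (δ)_i`. -/
def constExt (E : ExtData.{u, v, w} C) (I : Type t) :
    ExtFunctor E (E.pi I) (constFunctor C I) where
  app A B := AddMonoidHom.pi fun _ => AddMonoidHom.id (E.obj A B)
  app_pull _ _ := rfl
  app_push _ _ := rfl
  additive := { map_add := rfl }
  realizes h _ := h

/-! ### The conditions AET4(I) and AET4*(I) -/

/-- AET4(`I`), for a category with coproducts indexed by `I`: the functor `S = ∐` is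
`(1, T)`-extriangulated and the unit `φ : 1 ⟶ T ∘ S` is `(1, T)`-extriangulated. -/
def ExtData.AET4 (E : ExtData.{u, v, w} C) (I : Type t) [HasCoproductsOfShape I C] : Prop :=
  ∃ Γ : ExtFunctorAlong (E.pi I) E (coprodFunctor C I) (𝟭 (I → C)) (constFunctor C I),
    IsExtNatAlong ((ExtFunctor.id (E.pi I)).along (𝟭 (I → C)) (constFunctor C I))
      (Γ.comp (constExt E I)) (coprodUnit C I)

/-- AET4*(`I`), for a category with products indexed by `I`: the opposite extriangulated category
is AET4(`I`). -/
def ExtData.AET4Star (E : ExtData.{u, v, w} C) (I : Type t) [HasProductsOfShape I C] : Prop :=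
  E.op.AET4 I

end Extri

end Extriangulated

end

open Extriangulated

/-! The maps `τ` and `σ` are mutually inverse for two reasons: the triangle identity for the
adjunction, and the joint injectivity of the restrictions along the inclusions. The triangle
identity makes `Tⁿ(∇ · Γⁿ(ζ)) · φ = ζ` for every `ζ` in `𝔽ⁿ(D, TX)` (`toPiHigher_push_codiagonal`,
resting on `BifunctorHom.unit_higher`). Taking components gives that `τ ∘ σ` is the component map,
which is surjective because every element of a coend `E ◇ G` is a single tensor `x ⊗ y`, so one
tensor can be chosen per index and no bound on lengths is needed (`components_surjective`). Once `τ`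
is injective, so is the component map, and everything follows.

Injectivity of `τ` needs a criterion for `x ⊗ y = 0`: if `N ⟶ M` is the deflation in a realization
of `x ∈ 𝔼(M, B)`, then `y` lifts along it. The coend of sets already carries a group structure
coming from biproducts, so a property of pairs `(x, y)` that is stable under moving a morphism
across the tensor sign, and holds for the zero pair, holds whenever `x ⊗ y = 0`. For the property
"`y` comes along some `e` with `x · e = 0`" this stability follows from (ET4)ᵒᵖ and exactness of
`G(A, -)` in the middle. The criterion in turn passes this exactness from `G` to `E ◇ G`, so it is
available for all `𝔼ⁿ`. With it, `x ⊗ y` restricting to zero gives local lifts of `y`; these are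
glued by surjectivity in degree `n`, and induction identifies the glued lift with a lift of `y`
itself, whence `x ⊗ y = 0`.

Existence of `Γ_S` extends AET4 from constant to arbitrary second arguments: each `B i` is a summand
of `∐ B`, and the superfluous summand `∐ R` is cancelled from the realizations
(`ExtData.AET4.coprodCompatible`). The existence of `Γ_P` is obtained by passing to the opposite
category; the higher statements for products are proved directly. -/

noncomputable section

namespace Extriangulated

open scoped ZeroObject

/-! ### Realizations, exactness and opposites in an extriangulated category -/

section Basic

variable {C : Type u} [Category.{v} C] [Preadditive C]

namespace AddBifunctor

variable (E : AddBifunctor.{u, v, w} C)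

lemma push_zero {A B B' : C} (x : E.obj A B) : E.push (0 : B ⟶ B') x = 0 := by
  have h := E.push_add (0 : B ⟶ B') 0 x
  rwa [add_zero, left_eq_add] at h

lemma pull_zero {A A' B : C} (x : E.obj A B) : E.pull (0 : A' ⟶ A) x = 0 := by
  have h := E.pull_add (0 : A' ⟶ A) 0 x
  rwa [add_zero, left_eq_add] at h

lemma pull_neg {A A' B : C} (f : A' ⟶ A) (x : E.obj A B) : E.pull (-f) x = -E.pull f x := by
  rw [eq_neg_iff_add_eq_zero, ← E.pull_add, neg_add_cancel, E.pull_zero]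

end AddBifunctor

/-- The biproduct in the opposite category. -/
def unopBiprodIso [HasBinaryBiproducts C] (A B : Cᵒᵖ) : A.unop ⊞ B.unop ≅ (A ⊞ B).unop where
  hom := biprod.desc (biprod.fst : A ⊞ B ⟶ A).unop (biprod.snd : A ⊞ B ⟶ B).unop
  inv := biprod.lift (biprod.inl : A ⟶ A ⊞ B).unop (biprod.inr : B ⟶ A ⊞ B).unop
  hom_inv_id := by
    apply biprod.hom_ext' <;> apply biprod.hom_ext <;> simp [← unop_comp]
  inv_hom_id := by
    rw [biprod.lift_desc, ← unop_comp, ← unop_comp, ← unop_add, biprod.total]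
    rfl

section

variable [HasBinaryBiproducts C] (A B : Cᵒᵖ)

@[simp]
lemma inl_unopBiprodIso_hom :
    biprod.inl ≫ (unopBiprodIso A B).hom = (biprod.fst : A ⊞ B ⟶ A).unop := by
  simp [unopBiprodIso]

@[simp]
lemma inr_unopBiprodIso_hom :
    biprod.inr ≫ (unopBiprodIso A B).hom = (biprod.snd : A ⊞ B ⟶ B).unop := by
  simp [unopBiprodIso]

@[simp]
lemma unopBiprodIso_hom_inl :
    (unopBiprodIso A B).hom ≫ (biprod.inl : A ⟶ A ⊞ B).unop = biprod.fst := by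
  apply biprod.hom_ext' <;> simp [unopBiprodIso, ← unop_comp]

@[simp]
lemma unopBiprodIso_hom_inr :
    (unopBiprodIso A B).hom ≫ (biprod.inr : B ⟶ A ⊞ B).unop = biprod.snd := by
  apply biprod.hom_ext' <;> simp [unopBiprodIso, ← unop_comp]

end

variable [HasZeroObject C] [HasBinaryBiproducts C] {E : ExtData.{u, v, w} C}

namespace ExtData.IsExtriangulated

/-- This trivial sequence and its mirror image are test objects: comparing them with a realization
turns (ET3), (ET3)ᵒᵖ and the realization axiom into vanishing, lifting and factorization statements.
-/
lemma realizes_id_zero (hE : E.IsExtriangulated) (B : C) :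
    E.Realizes (0 : E.obj (0 : C) B) (𝟙 B) (0 : B ⟶ 0) := by
  refine (E.realizes_iff (hE.realizes_zero 0 B) _ _).2
    ⟨⟨biprod.fst, biprod.inl, ?_, by simp⟩, by simp, (isZero_zero C).eq_of_tgt _ _⟩
  exact biprod.hom_ext _ _ (by simp) ((isZero_zero C).eq_of_tgt _ _)

lemma realizes_zero_id (hE : E.IsExtriangulated) (A : C) :
    E.Realizes (0 : E.obj A (0 : C)) (0 : 0 ⟶ A) (𝟙 A) := by
  refine (E.realizes_iff (hE.realizes_zero A 0) _ _).2
    ⟨⟨biprod.snd, biprod.inr, ?_, by simp⟩, (isZero_zero C).eq_of_src _ _, by simp⟩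
  exact biprod.hom_ext _ _ ((isZero_zero C).eq_of_tgt _ _) (by simp)

variable {A B M : C} {δ : E.obj A B} {x : B ⟶ M} {y : M ⟶ A}

lemma pull_deflation (hE : E.IsExtriangulated) (h : E.Realizes δ x y) : E.pull y δ = 0 := by
  obtain ⟨a, ha, -⟩ := hE.et3_op (hE.realizes_zero_id M) h (𝟙 M) y (by simp)
  rw [← ha, map_zero]

lemma push_inflation (hE : E.IsExtriangulated) (h : E.Realizes δ x y) : E.push x δ = 0 := by
  obtain ⟨c, hc, -⟩ := hE.et3 h (hE.realizes_id_zero M) x (𝟙 M) (by simp)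
  rw [hc, map_zero]

lemma exists_lift (hE : E.IsExtriangulated) (h : E.Realizes δ x y) {X : C} (c : X ⟶ A)
    (hc : E.pull c δ = 0) : ∃ k : X ⟶ M, k ≫ y = c := by
  obtain ⟨b, -, hb⟩ := hE.realization (hE.realizes_zero_id X) h 0 c (by rw [hc, map_zero])
  exact ⟨b, by rw [← hb, Category.id_comp]⟩

lemma exists_desc (hE : E.IsExtriangulated) (h : E.Realizes δ x y) {X : C} (a : B ⟶ X)
    (ha : E.push a δ = 0) : ∃ k : M ⟶ X, x ≫ k = a := by
  obtain ⟨b, hb, -⟩ := hE.realization h (hE.realizes_id_zero X) a 0 (by rw [ha, map_zero])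
  exact ⟨b, by rw [hb, Category.comp_id]⟩

lemma exists_desc_of_comp_eq_zero (hE : E.IsExtriangulated) (h : E.Realizes δ x y) {X : C}
    (f : M ⟶ X) (hf : x ≫ f = 0) : ∃ k : A ⟶ X, y ≫ k = f := by
  obtain ⟨c, -, hc⟩ := hE.et3 h (hE.realizes_zero_id X) 0 f (by rw [hf, zero_comp])
  exact ⟨c, by rw [hc, Category.comp_id]⟩

/-- The difference `f - 𝟙` kills `x`, hence factors through `y`, and it is killed by `y`. Its square
is therefore zero, and `2 - f` is an inverse of `f`. -/
lemma isIso_of_endo (hE : E.IsExtriangulated) (h : E.Realizes δ x y) (f : M ⟶ M)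
    (hx : x ≫ f = x) (hy : f ≫ y = y) : IsIso f := by
  obtain ⟨k, hk⟩ := hE.exists_desc_of_comp_eq_zero h (f - 𝟙 M) (by simp [hx])
  have h0 : (f - 𝟙 M) ≫ (f - 𝟙 M) = 0 := by
    have h1 : (f - 𝟙 M) ≫ y = 0 := by simp [hy]
    calc (f - 𝟙 M) ≫ (f - 𝟙 M) = ((f - 𝟙 M) ≫ y) ≫ k := by rw [Category.assoc, hk]
      _ = 0 := by rw [h1, zero_comp]
  have hinv : f ≫ (𝟙 M + 𝟙 M - f) = 𝟙 M := by
    have : f ≫ (𝟙 M + 𝟙 M - f) = 𝟙 M - (f - 𝟙 M) ≫ (f - 𝟙 M) := by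
      simp only [Preadditive.comp_sub, Preadditive.sub_comp, Preadditive.comp_add,
        Category.comp_id, Category.id_comp]
      abel
    rw [this, h0, sub_zero]
  have hinv' : (𝟙 M + 𝟙 M - f) ≫ f = 𝟙 M := by
    have : (𝟙 M + 𝟙 M - f) ≫ f = 𝟙 M - (f - 𝟙 M) ≫ (f - 𝟙 M) := by
      simp only [Preadditive.comp_sub, Preadditive.sub_comp, Preadditive.add_comp,
        Category.comp_id, Category.id_comp]
      abel
    rw [this, h0, sub_zero]
  exact ⟨_, hinv, hinv'⟩

variable {A' B' M' : C} {δ' : E.obj A' B'} {x' : B' ⟶ M'} {y' : M' ⟶ A'}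

/-- A lift `b'` of the inverse pair need not invert `b`, but both composites fix the ends of their
sequences, so they are isomorphisms by `isIso_of_endo`. -/
lemma isIso_of_isos (hE : E.IsExtriangulated) (h : E.Realizes δ x y) (h' : E.Realizes δ' x' y')
    (a : B ≅ B') (b : M ⟶ M') (c : A ≅ A') (hδ : E.push a.hom δ = E.pull c.hom δ')
    (hx : x ≫ b = a.hom ≫ x') (hy : y ≫ c.hom = b ≫ y') : IsIso b := by
  have hδ' : E.push a.inv δ' = E.pull c.inv δ := by
    have e : δ' = E.pull c.inv (E.push a.hom δ) := by
      rw [hδ, ← E.pull_comp, c.inv_hom_id, E.pull_id]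
    rw [e, E.push_pull, ← E.push_comp, a.hom_inv_id, E.push_id]
  obtain ⟨b', hb₁, hb₂⟩ := hE.realization h' h a.inv c.inv hδ'
  have h₁ := hE.isIso_of_endo h (b ≫ b')
    (by rw [← Category.assoc, hx, Category.assoc, hb₁, a.hom_inv_id_assoc])
    (by rw [Category.assoc, ← hb₂, ← Category.assoc, ← hy, Category.assoc, c.hom_inv_id,
      Category.comp_id])
  have h₂ := hE.isIso_of_endo h' (b' ≫ b)
    (by rw [← Category.assoc, hb₁, Category.assoc, hx, a.inv_hom_id_assoc])
    (by rw [Category.assoc, ← hy, ← Category.assoc, ← hb₂, Category.assoc, c.inv_hom_id,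
      Category.comp_id])
  have : Mono b := mono_of_mono b b'
  have : IsSplitEpi b := ⟨⟨⟨inv (b' ≫ b) ≫ b', by simp⟩⟩⟩
  exact isIso_of_mono_of_isSplitEpi b

/-- Being a realization is invariant under isomorphisms of extensions and of sequences. -/
lemma realizes_of_iso (hE : E.IsExtriangulated) (h : E.Realizes δ x y)
    (a : B ≅ B') (b : M ≅ M') (c : A ≅ A') (hδ : E.push a.hom δ = E.pull c.hom δ')
    (hx : x ≫ b.hom = a.hom ≫ x') (hy : y ≫ c.hom = b.hom ≫ y') : E.Realizes δ' x' y' := by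
  obtain ⟨N, f, g, hN⟩ := E.exists_realizes δ'
  obtain ⟨d, hd₁, hd₂⟩ := hE.realization h hN a.hom c.hom hδ
  have := hE.isIso_of_isos h hN a d c hδ hd₁ hd₂
  refine (E.realizes_iff hN _ _).2 ⟨(asIso d).symm ≪≫ b, ?_, ?_⟩
  · rw [← cancel_epi a.hom, ← hx, ← Category.assoc, ← hd₁]
    simp
  · simp [← hy, hd₂]

/-- Exactness of `E(X, B) ⟶ E(X, M) ⟶ E(X, A)` for a realization `B ⟶ M ⟶ A`. -/
lemma exists_push_eq (hE : E.IsExtriangulated) (h : E.Realizes δ x y) {X : C} (η : E.obj X M)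
    (hη : E.push y η = 0) : ∃ ζ : E.obj X B, E.push x ζ = η := by
  obtain ⟨Y, g, g', hY⟩ := E.exists_realizes η
  obtain ⟨U, h', d, e, δ'', -, -, -, h₄, -, h₆⟩ := hE.et4 h hY
  -- The sequence `A ⟶ U ⟶ X` realizes `y · η = 0`, so `e` has a section `s`; the preimage of `η` is
  -- `δ'' · s`.
  obtain ⟨s, hs⟩ := hE.exists_lift (h₄) (𝟙 X) (by rw [hη, map_zero])
  exact ⟨E.pull s δ'', by rw [E.push_pull, h₆, ← E.pull_comp, hs, E.pull_id]⟩

/-- The opposite of an extriangulated category is extriangulated. -/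
lemma op (hE : E.IsExtriangulated) : E.op.IsExtriangulated where
  realization {A B M A' B' M' δ δ' x y x' y'} h h' a c hac := by
    obtain ⟨b, h₁, h₂⟩ := hE.realization (δ := δ') (δ' := δ) h' h c.unop a.unop hac.symm
    exact ⟨b.op, Quiver.Hom.unop_inj h₂.symm, Quiver.Hom.unop_inj h₁.symm⟩
  realizes_zero A B := by
    refine (E.realizes_iff (hE.realizes_zero B.unop A.unop) _ _).2
      ⟨biprod.braiding' _ _ ≪≫ unopBiprodIso B A, ?_, ?_⟩
    · simp
    · apply biprod.hom_ext' <;> simp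
  realizes_sum {A B M A' B' M' δ δ' x y x' y'} h h' := by
    refine hE.realizes_of_iso (hE.realizes_sum (δ := δ) (δ' := δ') h h')
      (unopBiprodIso A A') (unopBiprodIso M M') (unopBiprodIso B B') ?_ ?_ ?_
    · refine Eq.trans ?_ (map_add (E.pull (unopBiprodIso B B').hom)
        (E.pull (biprod.inl : B ⟶ B ⊞ B').unop (E.push (biprod.fst : A ⊞ A' ⟶ A).unop δ))
        (E.pull (biprod.inr : B' ⟶ B ⊞ B').unop (E.push (biprod.snd : A ⊞ A' ⟶ A').unop δ'))).symm
      rw [map_add, ← E.push_comp, ← E.push_comp, ← E.pull_comp, ← E.pull_comp,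
        inl_unopBiprodIso_hom, inr_unopBiprodIso_hom, unopBiprodIso_hom_inl,
        unopBiprodIso_hom_inr]
      exact congrArg₂ (· + ·) (E.push_pull _ _ _) (E.push_pull _ _ _)
    · apply biprod.hom_ext'
      · rw [biprod.inl_map_assoc, inl_unopBiprodIso_hom, reassoc_of% inl_unopBiprodIso_hom,
          ← unop_comp, ← unop_comp, biprod.map_fst]
      · rw [biprod.inr_map_assoc, inr_unopBiprodIso_hom, reassoc_of% inr_unopBiprodIso_hom,
          ← unop_comp, ← unop_comp, biprod.map_snd]
    · apply biprod.hom_ext'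
      · rw [biprod.inl_map_assoc, inl_unopBiprodIso_hom, reassoc_of% inl_unopBiprodIso_hom,
          ← unop_comp, ← unop_comp, biprod.map_fst]
      · rw [biprod.inr_map_assoc, inr_unopBiprodIso_hom, reassoc_of% inr_unopBiprodIso_hom,
          ← unop_comp, ← unop_comp, biprod.map_snd]
  et3 {A B M A' B' M' δ δ' x y x' y'} h h' a b hab := by
    obtain ⟨c, h₁, h₂⟩ := hE.et3_op (δ := δ') (δ' := δ) h' h b.unop a.unop
      (congrArg Quiver.Hom.unop hab.symm)
    exact ⟨c.op, h₁.symm, Quiver.Hom.unop_inj h₂.symm⟩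
  et3_op {A B M A' B' M' δ δ' x y x' y'} h h' b c hbc := by
    obtain ⟨a, h₁, h₂⟩ := hE.et3 (δ := δ') (δ' := δ) h' h c.unop b.unop
      (congrArg Quiver.Hom.unop hbc.symm)
    exact ⟨a.op, h₁.symm, Quiver.Hom.unop_inj h₂.symm⟩
  et4 {X Y Z W V δ δ' f f' g g'} h h' := by
    obtain ⟨U, h', d, e, δ'', h₁, h₂, h₃, h₄, h₅, h₆⟩ := hE.et4_op (δ := δ') (δ' := δ) h' h
    exact ⟨Opposite.op U, h'.op, e.op, d.op, δ'', Quiver.Hom.unop_inj h₁,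
      Quiver.Hom.unop_inj h₂, h₃, h₄, h₅, h₆.symm⟩
  et4_op {X Y Z W V δ δ' f' f g' g} h h' := by
    obtain ⟨U, h', d, e, δ'', h₁, h₂, h₃, h₄, h₅, h₆⟩ := hE.et4 (δ := δ') (δ' := δ) h' h
    exact ⟨Opposite.op U, h'.op, e.op, d.op, δ'', Quiver.Hom.unop_inj h₁,
      Quiver.Hom.unop_inj h₂, h₃, h₄, h₅, h₆.symm⟩

end ExtData.IsExtriangulated

end Basic

/-! ### Coends: simple tensors and the comparison with the coend of sets -/

section Tensors

variable {C : Type u} [Category.{v} C] [Preadditive C]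
variable {E : AddBifunctor.{u, v, w} C} {G : AddBifunctor.{u, v, w₁} C}

namespace Diamond

lemma mk_zero_left {A B M : C} (y : G.obj A M) : mk (0 : E.obj M B) y = 0 := by
  have h := mk_add_left (0 : E.obj M B) 0 y
  rwa [add_zero, left_eq_add] at h

lemma mk_neg_left {A B M : C} (x : E.obj M B) (y : G.obj A M) : mk (-x) y = -mk x y := by
  rw [eq_neg_iff_add_eq_zero, ← mk_add_left, neg_add_cancel, mk_zero_left]

/-- Expanding by bilinearity and balancing along the inclusions, the cross terms vanish. This is
what lets a sum of two tensors be absorbed into one over a biproduct. -/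
lemma mk_biprod [HasBinaryBiproducts C] {A B M M' : C} (x : E.obj M B) (y : G.obj A M)
    (x' : E.obj M' B) (y' : G.obj A M') :
    mk (E.pull (biprod.fst : M ⊞ M' ⟶ M) x + E.pull (biprod.snd : M ⊞ M' ⟶ M') x')
      (G.push biprod.inl y + G.push biprod.inr y') = mk x y + mk x' y' := by
  rw [mk_add_left, mk_balance, mk_balance, map_add, map_add]
  simp only [← G.push_comp, biprod.inl_fst, biprod.inr_fst, biprod.inl_snd, biprod.inr_snd,
    G.push_id, G.push_zero, add_zero, zero_add]

/-- Every element of `(E ◇ G)(A, B)` is of the form `x ⊗ y`. -/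
lemma exists_mk [HasBinaryBiproducts C] {A B : C} (z : Diamond E G A B) :
    ∃ (M : C) (x : E.obj M B) (y : G.obj A M), z = mk x y := by
  obtain ⟨z, rfl⟩ := QuotientAddGroup.mk_surjective z
  induction z using FreeAbelianGroup.induction_on with
  | zero => exact ⟨A, 0, 0, (mk_zero_left _).symm⟩
  | of p => exact ⟨p.1, p.2.1, p.2.2, rfl⟩
  | neg p h => exact ⟨p.1, -p.2.1, p.2.2, (mk_neg_left _ _).symm⟩
  | add a b ha hb =>
    obtain ⟨M, x, y, h⟩ := ha
    obtain ⟨M', x', y', h'⟩ := hb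
    exact ⟨M ⊞ M', _, _, (congrArg₂ (· + ·) h h').trans (mk_biprod x y x' y').symm⟩

end Diamond

/-- The elementary equivalences `(x · f) ⊗ y ∼ x ⊗ (f · y)` of simple tensors. -/
def TensorStep (E : AddBifunctor.{u, v, w} C) (G : AddBifunctor.{u, v, w₁} C) (A B : C)
    (p q : DiamondGen E G A B) : Prop :=
  ∃ f : p.1 ⟶ q.1, p.2.1 = E.pull f q.2.1 ∧ q.2.2 = G.push f p.2.2

/-- The set-valued coend of `E` and `G`: simple tensors up to elementary equivalences. -/
def Tensor (E : AddBifunctor.{u, v, w} C) (G : AddBifunctor.{u, v, w₁} C) (A B : C) :=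
  Quot (TensorStep E G A B)

namespace Tensor

variable {A B : C}

/-- The class of `x ⊗ y`. -/
def mk {M : C} (x : E.obj M B) (y : G.obj A M) : Tensor E G A B := Quot.mk _ ⟨M, x, y⟩

lemma ind {p : Tensor E G A B → Prop}
    (h : ∀ (M : C) (x : E.obj M B) (y : G.obj A M), p (mk x y)) (z : Tensor E G A B) : p z :=
  Quot.ind (fun _ => h _ _ _) z

lemma balance {M' M : C} (f : M' ⟶ M) (x : E.obj M B) (y : G.obj A M') :
    (mk (E.pull f x) y : Tensor E G A B) = mk x (G.push f y) :=
  Quot.sound ⟨f, rfl, rfl⟩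

lemma sound {M' M : C} (f : M' ⟶ M) {x' : E.obj M' B} {y' : G.obj A M'} {x : E.obj M B}
    {y : G.obj A M} (hx : E.pull f x = x') (hy : G.push f y' = y) :
    (mk x' y' : Tensor E G A B) = mk x y := by
  rw [← hx, ← hy, balance]

instance : Neg (Tensor E G A B) where
  neg := Quot.map (fun p => ⟨p.1, -p.2.1, p.2.2⟩) (by
    rintro ⟨N, z, w⟩ ⟨N', z', w'⟩ h
    obtain ⟨f, h₁, rfl⟩ : ∃ f : N ⟶ N', z = E.pull f z' ∧ w' = G.push f w := h
    subst h₁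
    exact ⟨f, by simp, rfl⟩)

lemma neg_mk {M : C} (x : E.obj M B) (y : G.obj A M) :
    (-mk x y : Tensor E G A B) = mk (-x) y := rfl

section

variable [HasZeroObject C]

instance : Zero (Tensor E G A B) where
  zero := mk (0 : E.obj 0 B) 0

lemma zero_def : (0 : Tensor E G A B) = mk (0 : E.obj 0 B) 0 := rfl

end

variable [HasBinaryBiproducts C]

instance : Add (Tensor E G A B) where
  add := Quot.map₂ (fun p q => ⟨p.1 ⊞ q.1, E.pull biprod.fst p.2.1 + E.pull biprod.snd q.2.1,
      G.push biprod.inl p.2.2 + G.push biprod.inr q.2.2⟩)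
    (by
      rintro ⟨M, x, y⟩ ⟨N, z, w⟩ ⟨N', z', w'⟩ h
      obtain ⟨f, h₁, rfl⟩ : ∃ f : N ⟶ N', z = E.pull f z' ∧ w' = G.push f w := h
      subst h₁
      exact ⟨biprod.map (𝟙 _) f, by simp [← E.pull_comp], by simp [← G.push_comp]⟩)
    (by
      rintro ⟨N, z, w⟩ ⟨N', z', w'⟩ ⟨M, x, y⟩ h
      obtain ⟨f, h₁, rfl⟩ : ∃ f : N ⟶ N', z = E.pull f z' ∧ w' = G.push f w := h
      subst h₁
      exact ⟨biprod.map f (𝟙 _), by simp [← E.pull_comp], by simp [← G.push_comp]⟩)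

lemma mk_add_mk {M M' : C} (x : E.obj M B) (y : G.obj A M) (x' : E.obj M' B)
    (y' : G.obj A M') : (mk x y + mk x' y' : Tensor E G A B) =
      mk (E.pull (biprod.fst : M ⊞ M' ⟶ M) x + E.pull (biprod.snd : M ⊞ M' ⟶ M') x')
        (G.push biprod.inl y + G.push biprod.inr y') := rfl

variable [HasZeroObject C]

instance : AddCommGroup (Tensor E G A B) :=
  have hcomm : ∀ a b : Tensor E G A B, a + b = b + a := fun a b => by
    induction a using ind with | _ M x y
    induction b using ind with | _ M' x' y'
    rw [mk_add_mk, mk_add_mk]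
    exact sound (biprod.lift biprod.snd biprod.fst)
      (by simp [← E.pull_comp, add_comm]) (by
        simp only [map_add, ← G.push_comp]
        rw [add_comm]
        congr 3 <;> apply biprod.hom_ext <;> simp)
  have hzero : ∀ a : Tensor E G A B, 0 + a = a := fun a => by
    induction a using ind with | _ M x y
    rw [zero_def, mk_add_mk]
    exact sound biprod.snd (by simp) (by simp [← G.push_comp, G.push_id])
  { add_assoc := fun a b c => by
      induction a using ind with | _ M x y
      induction b using ind with | _ M' x' y'
      induction c using ind with | _ M'' x'' y''
      simp only [mk_add_mk]
      exact sound (biprod.lift (biprod.fst ≫ biprod.fst)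
          (biprod.lift (biprod.fst ≫ biprod.snd) biprod.snd))
        (by simp [← E.pull_comp, add_assoc]) (by
          simp only [map_add, ← G.push_comp]
          rw [add_assoc]
          congr 4 <;> (try apply biprod.hom_ext) <;>
            (try rw [Category.assoc, Category.assoc, biprod.lift_snd]) <;>
            (try apply biprod.hom_ext) <;> simp)
    zero_add := hzero
    add_zero := fun a => by rw [hcomm, hzero]
    nsmul := nsmulRec
    zsmul := zsmulRec
    neg_add_cancel := fun a => by
      induction a using ind with | _ M x y
      rw [neg_mk, mk_add_mk, zero_def]
      -- The diagonal of `M` pulls `(-x, x)` back to `0`; then `0 ⊗ y` is moved to the zero object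
      -- along the zero morphism.
      have h : (mk (0 : E.obj M B) y : Tensor E G A B) =
          mk (E.pull (biprod.fst : M ⊞ M ⟶ M) (-x) + E.pull (biprod.snd : M ⊞ M ⟶ M) x)
            (G.push biprod.inl y + G.push biprod.inr y) :=
        sound (biprod.lift (𝟙 M) (𝟙 M)) (by simp [← E.pull_comp])
          (by rw [← G.push_add]; congr 2; apply biprod.hom_ext <;> simp)
      rw [← h]
      exact sound 0 (by simp) (by simp [G.push_zero])
    add_comm := hcomm }

/-- The comparison from the coend of abelian groups to the coend of sets. -/
def ofDiamond (E : AddBifunctor.{u, v, w} C) (G : AddBifunctor.{u, v, w₁} C) (A B : C) :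
    Diamond E G A B →+ Tensor E G A B :=
  Diamond.lift (fun _ x y => mk x y)
    -- Additivity is a case of balancing: along the diagonal `M ⟶ M ⊞ M` in the left variable, and
    -- along the codiagonal in the right one.
    (fun M x x' y => by
      rw [mk_add_mk]
      exact sound (biprod.lift (𝟙 M) (𝟙 M)) (by simp [← E.pull_comp, E.pull_id])
        (by rw [← G.push_add]; congr 2; apply biprod.hom_ext <;> simp))
    (fun M x y y' => by
      rw [mk_add_mk]
      exact (sound (biprod.desc (𝟙 M) (𝟙 M))
        (by rw [← E.pull_add]; congr 2; apply biprod.hom_ext' <;> simp)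
        (by simp [← G.push_comp, G.push_id])).symm)
    (fun _ _ f x y => balance f x y)

@[simp]
lemma ofDiamond_mk {M : C} (x : E.obj M B) (y : G.obj A M) :
    ofDiamond E G A B (Diamond.mk x y) = mk x y := Diamond.lift_mk _ _ _ _ _ _

end Tensor

/-- `y` comes from some `w` along a morphism `e` with `x · e = 0`. -/
def IsAnnihilated {A B M : C} (x : E.obj M B) (y : G.obj A M) : Prop :=
  ∃ (U : C) (e : U ⟶ M) (w : G.obj A U), E.pull e x = 0 ∧ G.push e w = y

/-- If `IsAnnihilated` is balanced, then `x ⊗ y = 0` holds only for annihilated pairs. -/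
lemma isAnnihilated_of_mk_eq_zero [HasZeroObject C] [HasBinaryBiproducts C]
    (H : ∀ {A B M' M : C} (f : M' ⟶ M) (x : E.obj M B) (y : G.obj A M'),
      IsAnnihilated (E.pull f x) y ↔ IsAnnihilated x (G.push f y))
    {A B M : C} {x : E.obj M B} {y : G.obj A M} (h : Diamond.mk x y = 0) :
    IsAnnihilated x y := by
  -- By `H` the property descends to the coend of sets. There `x ⊗ y` equals the zero class, because
  -- `ofDiamond` is additive.
  let P : Tensor E G A B → Prop := Quot.lift (fun p => IsAnnihilated p.2.1 p.2.2) (by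
    rintro ⟨N, z, w⟩ ⟨N', z', w'⟩ h
    obtain ⟨f, h₁, rfl⟩ : ∃ f : N ⟶ N', z = E.pull f z' ∧ w' = G.push f w := h
    subst h₁
    exact propext (H f z' w))
  have h0 : P 0 := ⟨0, 0, 0, by simp, by simp⟩
  have := congrArg (Tensor.ofDiamond E G A B) h
  rw [map_zero, Tensor.ofDiamond_mk] at this
  rw [← this] at h0
  exact h0

end Tensors

/-! ### Middle exactness of higher extensions and the vanishing criterion -/

section HalfExact

variable {C : Type u} [Category.{v} C] [Preadditive C]

/-- `G(A, -)` is exact in the middle on the sequences that realize extensions. -/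
def HalfExact (E : ExtData.{u, v, w} C) (G : AddBifunctor.{u, v, w₁} C) : Prop :=
  ∀ {A B M K : C} {δ : E.obj K B} {x : B ⟶ M} {y : M ⟶ K}, E.Realizes δ x y →
    ∀ η : G.obj A M, G.push y η = 0 → ∃ ζ : G.obj A B, G.push x ζ = η

variable [HasZeroObject C] [HasBinaryBiproducts C]
variable {E : ExtData.{u, v, w} C} {G : AddBifunctor.{u, v, w₁} C}

lemma IsAnnihilated.exists_push_eq (hE : E.IsExtriangulated) {A B M N : C} {x : E.obj M B}
    {y : G.obj A M} (h : IsAnnihilated (E := E.toAddBifunctor) x y) {f : B ⟶ N} {g : N ⟶ M}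
    (hx : E.Realizes x f g) : ∃ w : G.obj A N, G.push g w = y := by
  obtain ⟨U, e, w, he, hw⟩ := h
  obtain ⟨k, hk⟩ := hE.exists_lift hx e he
  exact ⟨G.push k w, by rw [← G.push_comp, hk, hw]⟩

/-- The substance is the backward direction. If `f · y = g · z` for the deflation `g` of `x`, then
`(y, -z)` is killed by `(f, g) : M' ⊞ N ⟶ M`. This map is again a deflation, its fibre `U` plays the
role of a pullback of `f` and `g` up to sign, and middle exactness brings `(y, -z)` from `U`. -/
lemma HalfExact.isAnnihilated_pull_iff (hE : E.IsExtriangulated) (hG : HalfExact E G)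
    {A B M' M : C} (f : M' ⟶ M) (x : E.obj M B) (y : G.obj A M') :
    IsAnnihilated (E := E.toAddBifunctor) (E.pull f x) y ↔
      IsAnnihilated (E := E.toAddBifunctor) x (G.push f y) := by
  constructor
  · rintro ⟨U, e, w, he, hw⟩
    exact ⟨U, e ≫ f, w, by rw [E.pull_comp, he], by rw [G.push_comp, hw]⟩
  · intro h
    obtain ⟨N, a, g, hx⟩ := E.exists_realizes x
    obtain ⟨z, hz⟩ := h.exists_push_eq hE hx
    -- The map `(f, g)` is written as `𝟙 ⊞ g` followed by `(f, 𝟙)`. Here `h₁` realizes `0 ⊕ x` with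
    -- deflation `𝟙 ⊞ g`, and `h₂` is the split sequence ending in `(f, 𝟙)`, so (ET4)ᵒᵖ applies.
    have h₁ := hE.realizes_sum (hE.realizes_zero_id M') hx
    have h₂ : E.Realizes (0 : E.obj M M') (biprod.lift (𝟙 M') (-f)) (biprod.desc f (𝟙 M)) := by
      refine (E.realizes_iff (hE.realizes_zero M M') _ _).2
        ⟨⟨biprod.lift biprod.fst (biprod.snd - biprod.fst ≫ f),
          biprod.lift biprod.fst (biprod.snd + biprod.fst ≫ f), ?_, ?_⟩, ?_, ?_⟩
      · apply biprod.hom_ext <;> simp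
      · apply biprod.hom_ext <;> simp
      · apply biprod.hom_ext <;> simp
      · apply biprod.hom_ext' <;> simp
    obtain ⟨U, k, d, e, δ'', hk, -, hU, hd, -, -⟩ := hE.et4_op h₁ h₂
    obtain ⟨w, hw⟩ := hG hU (G.push biprod.inl y - G.push biprod.inr z) (by
      rw [(G.push _).map_sub, ← G.push_comp, ← G.push_comp, biprod.inl_map_assoc,
        biprod.inr_map_assoc]
      simp [hz])
    refine ⟨U, e, w, ?_, ?_⟩
    -- The map `e` is the deflation of `(0 ⊕ x) · (𝟙, -f)`, whose component in `B` is `-(x · f)`.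
    · have h₃ := hE.pull_deflation hd
      have h₄ := congrArg (E.push biprod.snd) h₃
      simp only [map_zero, zero_add, E.push_pull, ← E.push_comp, biprod.inr_snd, E.push_id] at h₄
      rw [← E.pull_comp, ← E.pull_comp, Category.assoc, biprod.lift_snd, E.pull_comp, E.pull_neg, (E.pull e).map_neg, neg_eq_zero] at h₄
      exact h₄
    · have h₅ : k ≫ biprod.fst = e := by
        simpa using hk =≫ biprod.fst
      have h₆ := congrArg (G.push biprod.fst) hw
      rw [map_sub, ← G.push_comp, ← G.push_comp, ← G.push_comp, h₅] at h₆
      simpa [G.push_id, G.push_zero] using h₆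

/-- `x ⊗ y = 0` holds only if `y` lifts along the deflation of a realization of `x`. -/
lemma HalfExact.exists_push_eq_of_mk_eq_zero (hE : E.IsExtriangulated) (hG : HalfExact E G)
    {A B M N : C} {x : E.obj M B} {y : G.obj A M} {f : B ⟶ N} {g : N ⟶ M}
    (hx : E.Realizes x f g) (h : Diamond.mk (E := E.toAddBifunctor) x y = 0) :
    ∃ w : G.obj A N, G.push g w = y :=
  (isAnnihilated_of_mk_eq_zero (hG.isAnnihilated_pull_iff hE) h).exists_push_eq hE hx

/-- Write `η = p ⊗ q`. The criterion applied to `(y · p) ⊗ q = 0` lifts `q` to `g · w` along the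
deflation `g` of `y · p`. Then `y` kills `p · g`, so `p · g = x · r`, and `r ⊗ w` is the required
preimage. -/
lemma HalfExact.diamond (hE : E.IsExtriangulated) (hG : HalfExact E G) :
    HalfExact E (E.toAddBifunctor.diamond G) := by
  intro A B M K δ x y h η hη
  obtain ⟨L, p, q, rfl⟩ := Diamond.exists_mk η
  obtain ⟨N, f, g, hp⟩ := E.exists_realizes (E.push y p)
  obtain ⟨w, rfl⟩ := hG.exists_push_eq_of_mk_eq_zero hE hp
    ((Diamond.push_mk y p q).symm.trans hη)
  obtain ⟨r, hr⟩ := hE.exists_push_eq h (E.pull g p)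
    (by rw [E.push_pull, hE.pull_deflation hp])
  refine ⟨Diamond.mk r w, (Diamond.push_mk x r w).trans ?_⟩
  rw [hr, Diamond.mk_balance]

lemma halfExact_higher (hE : E.IsExtriangulated) : ∀ n, HalfExact E (E.higher n)
  | 0 => by
    intro h η hη
    obtain ⟨ζ, hζ⟩ := hE.exists_push_eq h η.down (congrArg ULift.down hη)
    exact ⟨⟨ζ⟩, congrArg ULift.up hζ⟩
  | n + 1 => HalfExact.diamond hE (halfExact_higher hE n)

end HalfExact

/-! ### Direct sum decompositions and coproducts -/

section Splitting

variable {C : Type u} [Category.{v} C] {I : Type t}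

lemma sigmaMap_comp [HasCoproductsOfShape I C] {X Y Z : I → C} (f : ∀ i, X i ⟶ Y i)
    (g : ∀ i, Y i ⟶ Z i) :
    Limits.Sigma.map f ≫ Limits.Sigma.map g = Limits.Sigma.map fun i => f i ≫ g i :=
  Limits.Sigma.hom_ext _ _ fun i => by simp

lemma sigmaMap_id' [HasCoproductsOfShape I C] {X : I → C} {f : ∀ i, X i ⟶ X i}
    (h : ∀ i, f i = 𝟙 _) : Limits.Sigma.map f = 𝟙 (∐ X) :=
  Limits.Sigma.hom_ext _ _ fun i => by simp [h]

variable [Preadditive C]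

lemma sigmaMap_add [HasCoproductsOfShape I C] {X Y : I → C} (f g : ∀ i, X i ⟶ Y i) :
    (Limits.Sigma.map fun i => f i + g i) = Limits.Sigma.map f + Limits.Sigma.map g :=
  Limits.Sigma.hom_ext _ _ fun i => by simp

lemma sigmaMap_zero [HasCoproductsOfShape I C] {X Y : I → C} {f : ∀ i, X i ⟶ Y i}
    (h : ∀ i, f i = 0) : Limits.Sigma.map f = 0 :=
  Limits.Sigma.hom_ext _ _ fun i => by simp [h]

/-- `X` is the direct sum of `B` and `R`. -/
structure Splitting (B R X : C) where
  /-- the first inclusion -/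
  inl : B ⟶ X
  /-- the second inclusion -/
  inr : R ⟶ X
  /-- the first projection -/
  fst : X ⟶ B
  /-- the second projection -/
  snd : X ⟶ R
  inl_fst : inl ≫ fst = 𝟙 B
  inr_snd : inr ≫ snd = 𝟙 R
  inl_snd : inl ≫ snd = 0
  inr_fst : inr ≫ fst = 0
  total : fst ≫ inl + snd ≫ inr = 𝟙 X

attribute [simp] Splitting.inl_fst Splitting.inr_snd Splitting.inl_snd Splitting.inr_fst

namespace Splitting

section

variable {B R X Z : C} (s : Splitting B R X)

@[simp]
lemma inl_fst_assoc (h : B ⟶ Z) : s.inl ≫ s.fst ≫ h = h := by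
  rw [← Category.assoc, inl_fst, Category.id_comp]

@[simp]
lemma inr_fst_assoc (h : B ⟶ Z) : s.inr ≫ s.fst ≫ h = 0 := by
  rw [← Category.assoc, inr_fst, zero_comp]

end

/-- The splitting of a biproduct. -/
@[simps]
def biprod [HasBinaryBiproducts C] (B R : C) : Splitting B R (B ⊞ R) where
  inl := Limits.biprod.inl
  inr := Limits.biprod.inr
  fst := Limits.biprod.fst
  snd := Limits.biprod.snd
  inl_fst := by simp
  inr_snd := by simp
  inl_snd := by simp
  inr_fst := by simp
  total := Limits.biprod.total

/-- The coproduct of splittings. -/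
@[simps]
def sigma [HasCoproductsOfShape I C] {B R X : I → C} (s : ∀ i, Splitting (B i) (R i) (X i)) :
    Splitting (∐ B) (∐ R) (∐ X) where
  inl := Limits.Sigma.map fun i => (s i).inl
  inr := Limits.Sigma.map fun i => (s i).inr
  fst := Limits.Sigma.map fun i => (s i).fst
  snd := Limits.Sigma.map fun i => (s i).snd
  inl_fst := by rw [sigmaMap_comp, sigmaMap_id' fun i => (s i).inl_fst]
  inr_snd := by rw [sigmaMap_comp, sigmaMap_id' fun i => (s i).inr_snd]
  inl_snd := by rw [sigmaMap_comp, sigmaMap_zero fun i => (s i).inl_snd]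
  inr_fst := by rw [sigmaMap_comp, sigmaMap_zero fun i => (s i).inr_fst]
  total := by
    rw [sigmaMap_comp, sigmaMap_comp, ← sigmaMap_add, sigmaMap_id' fun i => (s i).total]

/-- A splitting as an isomorphism with the biproduct. -/
@[simps]
def iso [HasBinaryBiproducts C] {B R X : C} (s : Splitting B R X) : B ⊞ R ≅ X where
  hom := biprod.desc s.inl s.inr
  inv := biprod.lift s.fst s.snd
  hom_inv_id := by apply biprod.hom_ext' <;> apply biprod.hom_ext <;> simp
  inv_hom_id := by rw [biprod.lift_desc, s.total]

/-- Cancellation of a common summand. -/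
@[simps]
def cancel {M N R X Y : C} (s : Splitting M R X) (s' : Splitting N R Y) (e : X ≅ Y)
    (h : s.inr ≫ e.hom = s'.inr) : M ≅ N where
  hom := s.inl ≫ e.hom ≫ s'.fst
  inv := s'.inl ≫ e.inv ≫ s.fst
  -- Since `e` carries the summand `R` identically to `R`, it is triangular, and its diagonal entry
  -- `M ⟶ N` is inverted by that of `e.inv`.
  hom_inv_id := by
    have h' : s'.inr ≫ e.inv = s.inr := by rw [← h, Category.assoc, e.hom_inv_id, Category.comp_id]
    have ht : s'.fst ≫ s'.inl = 𝟙 Y - s'.snd ≫ s'.inr := by rw [← s'.total, add_sub_cancel_right]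
    simp only [Category.assoc, reassoc_of% ht, Preadditive.sub_comp, Preadditive.comp_sub,
      reassoc_of% h']
    simp
  inv_hom_id := by
    have ht : s.fst ≫ s.inl = 𝟙 X - s.snd ≫ s.inr := by rw [← s.total, add_sub_cancel_right]
    simp only [Category.assoc, reassoc_of% ht, Preadditive.sub_comp, Preadditive.comp_sub,
      reassoc_of% h]
    simp

open Classical in
/-- Every summand of a coproduct has a complement. -/
lemma exists_ι [HasZeroObject C] [HasCoproductsOfShape I C] (B : I → C) (k : I) :
    ∃ (R : C) (s : Splitting (B k) R (∐ B)), s.inl = Limits.Sigma.ι B k := by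
  -- The complement of `B k` is the coproduct of the family with its `k`-th member replaced by zero.
  let R : I → C := fun j => if j = k then 0 else B j
  let f : ∀ j, B j ⟶ R j := fun j => if h : j = k then 0 else eqToHom (if_neg h).symm
  let g : ∀ j, R j ⟶ B j := fun j => if h : j = k then 0 else eqToHom (if_neg h)
  let p : ∀ j, B j ⟶ B k := fun j => if h : j = k then eqToHom (congrArg B h) else 0
  have hp : p k = 𝟙 _ := by simp [p]
  have hf : f k = 0 := by simp [f]
  have hgf : ∀ j, g j ≫ f j = 𝟙 _ := fun j => by
    by_cases h : j = k
    · have : IsZero (R j) := by simpa [R, h] using isZero_zero C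
      exact this.eq_of_src _ _
    · simp [f, g, h]
  have hgp : ∀ j, g j ≫ p j = 0 := fun j => by
    by_cases h : j = k
    · simp [g, h]
    · simp [p, h]
  refine ⟨∐ R, ⟨Limits.Sigma.ι B k, Limits.Sigma.map g, Limits.Sigma.desc p, Limits.Sigma.map f,
    by simp [hp], by rw [sigmaMap_comp, sigmaMap_id' hgf], by simp [hf], ?_, ?_⟩, rfl⟩
  · exact Limits.Sigma.hom_ext _ _ fun j => by simp [hgp]
  · refine Limits.Sigma.hom_ext _ _ fun j => ?_
    by_cases h : j = k
    · subst h
      simp [hp, hf]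
    · simp [p, f, g, h]

end Splitting

end Splitting

/-! ### Existence of the extriangulated structures on `∐` and `∏` -/

section Existence

variable {C : Type u} [Category.{v} C] {I : Type t}

/-- The product as a coproduct in the opposite category. -/
def piIsoUnopSigma [HasProductsOfShape I C] (A : I → C) :
    ∏ᶜ A ≅ (∐ fun i => Opposite.op (A i)).unop where
  hom := (Limits.Sigma.desc fun i => (Limits.Pi.π A i).op).unop
  inv := Limits.Pi.lift fun i => (Limits.Sigma.ι (fun i => Opposite.op (A i)) i).unop
  hom_inv_id := Limits.Pi.hom_ext _ _ fun i => by simp [← unop_comp]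
  inv_hom_id := Quiver.Hom.op_inj (Limits.Sigma.hom_ext _ _ fun i => Quiver.Hom.unop_inj (by simp))

lemma piIsoUnopSigma_hom_ι [HasProductsOfShape I C] (A : I → C) (i : I) :
    (piIsoUnopSigma A).hom ≫ (Limits.Sigma.ι (fun i => Opposite.op (A i)) i).unop =
      Limits.Pi.π A i := by
  simp [piIsoUnopSigma, ← unop_comp]

lemma piIsoUnopSigma_inv_π [HasProductsOfShape I C] (A : I → C) (i : I) :
    (piIsoUnopSigma A).inv ≫ Limits.Pi.π A i =
      (Limits.Sigma.ι (fun i => Opposite.op (A i)) i).unop := by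
  simp [piIsoUnopSigma]

lemma piIsoUnopSigma_inv_naturality [HasProductsOfShape I C] {A B : I → C} (f : ∀ i, A i ⟶ B i) :
    (Limits.Sigma.map fun i => (f i).op).unop ≫ (piIsoUnopSigma B).inv =
      (piIsoUnopSigma A).inv ≫ Limits.Pi.map f :=
  Limits.Pi.hom_ext _ _ fun i => by
    rw [Category.assoc, Category.assoc, piIsoUnopSigma_inv_π, Limits.Pi.map_π, ← unop_comp,
      Limits.Sigma.ι_map, reassoc_of% piIsoUnopSigma_inv_π]
    rfl

variable [Preadditive C] {E : ExtData.{u, v, w} C}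

/-- The elementwise description of a structure of extriangulated functor on `∐` with
extriangulated unit. -/
def CoprodCompatible (E : ExtData.{u, v, w} C) (I : Type t) [HasCoproductsOfShape I C] : Prop :=
  ∀ (A B : I → C) (δ : ∀ i, E.obj (A i) (B i)), ∃ γ : E.obj (∐ A) (∐ B),
    (∀ i, E.pull (Limits.Sigma.ι A i) γ = E.push (Limits.Sigma.ι B i) (δ i)) ∧
    ∀ (M : I → C) (f : ∀ i, B i ⟶ M i) (g : ∀ i, M i ⟶ A i),
      (∀ i, E.Realizes (δ i) (f i) (g i)) →
        E.Realizes γ (Limits.Sigma.map f) (Limits.Sigma.map g)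

/-- The elementwise description of a structure of extriangulated functor on `∏` with
extriangulated counit. -/
def ProdCompatible (E : ExtData.{u, v, w} C) (I : Type t) [HasProductsOfShape I C] : Prop :=
  ∀ (A B : I → C) (δ : ∀ i, E.obj (A i) (B i)), ∃ γ : E.obj (∏ᶜ A) (∏ᶜ B),
    (∀ i, E.push (Limits.Pi.π B i) γ = E.pull (Limits.Pi.π A i) (δ i)) ∧
    ∀ (M : I → C) (f : ∀ i, B i ⟶ M i) (g : ∀ i, M i ⟶ A i),
      (∀ i, E.Realizes (δ i) (f i) (g i)) →
        E.Realizes γ (Limits.Pi.map f) (Limits.Pi.map g)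

lemma ExtData.AET4.exists_const [HasCoproductsOfShape I C] (h : E.AET4 I) (A : I → C) (X : C)
    (δ : ∀ i, E.obj (A i) X) : ∃ γ : E.obj (∐ A) (∐ fun _ : I => X),
    (∀ i, E.pull (Limits.Sigma.ι A i) γ = E.push (Limits.Sigma.ι (fun _ => X) i) (δ i)) ∧
    ∀ (M : I → C) (f : ∀ i, X ⟶ M i) (g : ∀ i, M i ⟶ A i),
      (∀ i, E.Realizes (δ i) (f i) (g i)) →
        E.Realizes γ (Limits.Sigma.map f) (Limits.Sigma.map g) := by
  obtain ⟨Γ, hΓ⟩ := h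
  exact ⟨Γ.app A X δ, fun i => (congrFun (hΓ A X δ) i).symm,
    fun M f g hfg => Γ.realizes (X := A) (Y := X) (M := M) hfg⟩

variable [HasZeroObject C] [HasBinaryBiproducts C]

namespace ExtData.IsExtriangulated

/-- The inclusions lift along the deflation of a realization, and the lifts assemble to a section of
it. No condition on coproducts beyond their existence enters. -/
lemma eq_zero_of_pull_ι (hE : E.IsExtriangulated) [HasCoproductsOfShape I C] {D : I → C} {X : C}
    (η : E.obj (∐ D) X) (h : ∀ i, E.pull (Limits.Sigma.ι D i) η = 0) : η = 0 := by
  obtain ⟨M, f, g, hM⟩ := E.exists_realizes η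
  choose k hk using fun i => hE.exists_lift hM _ (h i)
  have hs : Limits.Sigma.desc k ≫ g = 𝟙 _ := Limits.Sigma.hom_ext _ _ fun i => by simp [hk]
  rw [← E.pull_id η, ← hs, E.pull_comp, hE.pull_deflation hM, map_zero]

lemma pull_ι_ext (hE : E.IsExtriangulated) [HasCoproductsOfShape I C] {D : I → C} {X : C}
    {η η' : E.obj (∐ D) X}
    (h : ∀ i, E.pull (Limits.Sigma.ι D i) η = E.pull (Limits.Sigma.ι D i) η') : η = η' :=
  sub_eq_zero.1 (hE.eq_zero_of_pull_ι _ fun i => by rw [map_sub, h, sub_self])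

lemma eq_zero_of_push_π (hE : E.IsExtriangulated) [HasProductsOfShape I C] {D : I → C} {X : C}
    (η : E.obj X (∏ᶜ D)) (h : ∀ i, E.push (Limits.Pi.π D i) η = 0) : η = 0 := by
  obtain ⟨M, f, g, hM⟩ := E.exists_realizes η
  choose k hk using fun i => hE.exists_desc hM _ (h i)
  have hs : f ≫ Limits.Pi.lift k = 𝟙 _ := Limits.Pi.hom_ext _ _ fun i => by simp [hk]
  rw [← E.push_id η, ← hs, E.push_comp, hE.push_inflation hM, map_zero]

lemma push_π_ext (hE : E.IsExtriangulated) [HasProductsOfShape I C] {D : I → C} {X : C}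
    {η η' : E.obj X (∏ᶜ D)}
    (h : ∀ i, E.push (Limits.Pi.π D i) η = E.push (Limits.Pi.π D i) η') : η = η' :=
  sub_eq_zero.1 (hE.eq_zero_of_push_π _ fun i => by rw [map_sub, h, sub_self])

/-- The realization of the push-forward of an extension along a split monomorphism. -/
lemma realizes_push_splitting (hE : E.IsExtriangulated) {A B M R X : C} {δ : E.obj A B}
    {x : B ⟶ M} {y : M ⟶ A} (h : E.Realizes δ x y) (s : Splitting B R X) :
    E.Realizes (E.push s.inl δ) (biprod.lift (s.fst ≫ x) s.snd) (biprod.fst ≫ y) := by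
  refine hE.realizes_of_iso (hE.realizes_sum h (hE.realizes_id_zero R)) s.iso (Iso.refl _)
    ⟨biprod.fst, biprod.inl, ?_, by simp⟩ ?_ ?_ ?_
  · exact biprod.hom_ext _ _ (by simp) ((isZero_zero C).eq_of_tgt _ _)
  · simp only [map_zero, add_zero, ← E.push_comp, ← E.push_pull, Splitting.iso_hom,
      biprod.inl_desc]
  · apply biprod.hom_ext' <;> apply biprod.hom_ext <;> simp
  · simp

end ExtData.IsExtriangulated

/-- Push every `δ i` into the constant family `∐ B`, apply AET4 there to get `γ'`, and project back
to `γ`. A realization `N` of `γ` and the middle terms `M i` then satisfy `N ⊕ ∐ R ≅ ∐ (M i ⊕ R i)`,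
from which `∐ R` is cancelled. -/
lemma ExtData.AET4.coprodCompatible (hE : E.IsExtriangulated) [HasCoproductsOfShape I C]
    (h : E.AET4 I) : CoprodCompatible E I := by
  intro A B δ
  choose R s hs using Splitting.exists_ι B
  obtain ⟨γ', h₁, h₄⟩ := h.exists_const A (∐ B) fun i => E.push (s i).inl (δ i)
  let S := Splitting.sigma s
  obtain ⟨γ, hγ⟩ : ∃ γ, γ = E.push S.fst γ' := ⟨_, rfl⟩
  have h₂ : ∀ i, E.pull (Limits.Sigma.ι A i) γ = E.push (Limits.Sigma.ι B i) (δ i) := fun i => by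
    rw [hγ, ← E.push_pull, h₁, ← E.push_comp, ← E.push_comp]
    simp [S]
  -- No information is lost in projecting: both sides have the same restrictions to the `A i`. Hence
  -- a realization of `γ` plus `∐ R` realizes `γ'`.
  have h₃ : E.push S.inl γ = γ' := hE.pull_ι_ext fun i => by
    rw [← E.push_pull, h₁, h₂, ← E.push_comp, ← E.push_comp]
    simp [S, hs]
  refine ⟨γ, h₂, fun M f g hfg => ?_⟩
  have h₄ := h₄ _ _ _ fun i => hE.realizes_push_splitting (hfg i) (s i)
  obtain ⟨N, n, n', hN⟩ := E.exists_realizes γ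
  have h₅ := hE.realizes_push_splitting hN S
  rw [h₃] at h₅
  obtain ⟨θ, hθ₁, hθ₂⟩ := (E.realizes_iff h₄ _ _).1 h₅
  -- An equivalence of realizations respects the inflations; restricting it to the summand `∐ R`
  -- gives the hypothesis needed for cancellation.
  have hinr : Limits.Sigma.map (fun _ => biprod.inr) ≫ θ.hom = biprod.inr := by
    have h₆ := S.inr ≫= hθ₁
    rw [Splitting.sigma_inr, reassoc_of% sigmaMap_comp] at h₆
    have e₁ : ∀ i, (s i).inr ≫ biprod.lift ((s i).fst ≫ f i) (s i).snd = biprod.inr :=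
      fun i => by apply biprod.hom_ext <;> simp
    have e₂ : S.inr ≫ biprod.lift (S.fst ≫ n) S.snd = biprod.inr := by
      apply biprod.hom_ext
      · rw [Category.assoc, biprod.lift_fst, S.inr_fst_assoc, biprod.inr_fst]
      · rw [Category.assoc, biprod.lift_snd, S.inr_snd, biprod.inr_snd]
    simp only [e₁] at h₆
    exact h₆.trans e₂
  let e := (Splitting.sigma fun i => Splitting.biprod (M i) (R i)).cancel
    (Splitting.biprod N (∐ R)) θ hinr
  have he : e.hom = Limits.Sigma.map (fun _ => biprod.inl) ≫ θ.hom ≫ biprod.fst := rfl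
  refine (E.realizes_iff hN _ _).2 ⟨e.symm, ?_, ?_⟩
  · rw [Iso.symm_hom, Iso.comp_inv_eq, he, reassoc_of% sigmaMap_comp]
    have e₁ : ∀ i, (s i).inl ≫ biprod.lift ((s i).fst ≫ f i) (s i).snd = f i ≫ biprod.inl :=
      fun i => by apply biprod.hom_ext <;> simp
    have h₆ := S.inl ≫= hθ₁ =≫ biprod.fst
    rw [Splitting.sigma_inl, Category.assoc, reassoc_of% sigmaMap_comp, biprod.lift_fst] at h₆
    simp only [e₁] at h₆
    exact (S.inl_fst_assoc n).symm.trans h₆.symm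
  · rw [Iso.symm_hom, Iso.inv_comp_eq, he, Category.assoc, Category.assoc, hθ₂, sigmaMap_comp]
    simp

/-- The class `γ` is determined by its restrictions, so additivity and naturality may be checked
after restriction, where they are immediate. -/
lemma exists_extFunctor_of_coprodCompatible (hE : E.IsExtriangulated) [HasCoproductsOfShape I C]
    (h : CoprodCompatible E I) : ∃ Γ : ExtFunctor (E.pi I) E (coprodFunctor C I),
      IsExtNat (ExtFunctor.id (E.pi I)) (Γ.comp (constExt E I)) (coprodUnit C I) := by
  choose γ h₁ h₂ using h
  have hadd : ∀ (A B : I → C) (δ δ' : ∀ i, E.obj (A i) (B i)),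
      γ A B (fun i => δ i + δ' i) = γ A B δ + γ A B δ' := fun A B δ δ' =>
    hE.pull_ι_ext fun i => by rw [map_add, h₁, h₁, h₁, map_add]
  have hpull : ∀ {A' A B : I → C} (f : ∀ i, A' i ⟶ A i) (δ : ∀ i, E.obj (A i) (B i)),
      γ A' B (fun i => E.pull (f i) (δ i)) = E.pull (Limits.Sigma.map f) (γ A B δ) :=
    fun f δ => hE.pull_ι_ext fun i => by
      rw [h₁, ← E.pull_comp, Limits.Sigma.ι_map, E.pull_comp, h₁, E.push_pull]
  have hpush : ∀ {A B B' : I → C} (g : ∀ i, B i ⟶ B' i) (δ : ∀ i, E.obj (A i) (B i)),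
      γ A B' (fun i => E.push (g i) (δ i)) = E.push (Limits.Sigma.map g) (γ A B δ) :=
    fun g δ => hE.pull_ι_ext fun i => by
      rw [h₁, ← E.push_pull, h₁, ← E.push_comp, ← E.push_comp, Limits.Sigma.ι_map]
  exact ⟨{ app := fun A B => AddMonoidHom.mk' (γ A B) (hadd A B)
           app_pull := hpull
           app_push := hpush
           additive := ⟨fun {X Y f g} => sigmaMap_add f g⟩
           realizes := fun {A B M δ f g} h => h₂ A B δ M f g h },
    fun A B δ => funext fun i => (h₁ A B δ i).symm⟩

lemma exists_extFunctor_of_prodCompatible (hE : E.IsExtriangulated) [HasProductsOfShape I C]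
    (h : ProdCompatible E I) : ∃ Γ : ExtFunctor (E.pi I) E (prodFunctor C I),
      IsExtNat (Γ.comp (constExt E I)) (ExtFunctor.id (E.pi I)) (prodCounit C I) := by
  choose γ h₁ h₂ using h
  have hadd : ∀ (A B : I → C) (δ δ' : ∀ i, E.obj (A i) (B i)),
      γ A B (fun i => δ i + δ' i) = γ A B δ + γ A B δ' := fun A B δ δ' =>
    hE.push_π_ext fun i => by rw [map_add, h₁, h₁, h₁, map_add]
  have hpull : ∀ {A' A B : I → C} (f : ∀ i, A' i ⟶ A i) (δ : ∀ i, E.obj (A i) (B i)),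
      γ A' B (fun i => E.pull (f i) (δ i)) = E.pull (Limits.Pi.map f) (γ A B δ) :=
    fun f δ => hE.push_π_ext fun i => by
      rw [h₁, E.push_pull, h₁, ← E.pull_comp, ← E.pull_comp, Limits.Pi.map_π]
  have hpush : ∀ {A B B' : I → C} (g : ∀ i, B i ⟶ B' i) (δ : ∀ i, E.obj (A i) (B i)),
      γ A B' (fun i => E.push (g i) (δ i)) = E.push (Limits.Pi.map g) (γ A B δ) :=
    fun g δ => hE.push_π_ext fun i => by
      rw [h₁, ← E.push_comp, Limits.Pi.map_π, E.push_comp, h₁, E.push_pull]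
  exact ⟨{ app := fun A B => AddMonoidHom.mk' (γ A B) (hadd A B)
           app_pull := hpull
           app_push := hpush
           additive := ⟨fun {X Y f g} => Limits.Pi.hom_ext _ _ fun i => by
              change Limits.Pi.map (fun i => f i + g i) ≫ _ =
                (Limits.Pi.map f + Limits.Pi.map g) ≫ _
              simp⟩
           realizes := fun {A B M δ f g} h => h₂ A B δ M f g h },
    fun A B δ => funext fun i => h₁ A B δ i⟩

lemma prodCompatible_of_op (hE : E.IsExtriangulated) [HasProductsOfShape I C]
    (h : CoprodCompatible E.op I) : ProdCompatible E I := by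
  intro A B δ
  obtain ⟨γ, h₁, h₂⟩ := h (fun i => Opposite.op (B i)) (fun i => Opposite.op (A i)) δ
  -- The same extension, now read in `𝔼` instead of `𝔼ᵒᵖ`.
  obtain ⟨γ', hγ'⟩ : ∃ γ' : E.obj (∐ fun i => Opposite.op (A i)).unop
    (∐ fun i => Opposite.op (B i)).unop, γ' = γ := ⟨γ, rfl⟩
  have h₁' : ∀ i, E.push (Limits.Sigma.ι (fun i => Opposite.op (B i)) i).unop γ' =
    E.pull (Limits.Sigma.ι (fun i => Opposite.op (A i)) i).unop (δ i) := by
      subst hγ'; exact h₁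
  refine ⟨E.push (piIsoUnopSigma B).inv (E.pull (piIsoUnopSigma A).hom γ'), fun i => ?_,
    fun M f g hfg => ?_⟩
  · rw [← E.push_comp, piIsoUnopSigma_inv_π, E.push_pull, h₁', ← E.pull_comp,
      piIsoUnopSigma_hom_ι]
  · have h₃ : E.Realizes γ' (Limits.Sigma.map fun i => (f i).op).unop
        (Limits.Sigma.map fun i => (g i).op).unop := by
      subst hγ'
      exact h₂ (fun i => Opposite.op (M i)) (fun i => (g i).op) (fun i => (f i).op) hfg
    refine hE.realizes_of_iso h₃ (piIsoUnopSigma B).symm (piIsoUnopSigma M).symm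
      (piIsoUnopSigma A).symm ?_ (piIsoUnopSigma_inv_naturality f)
      (piIsoUnopSigma_inv_naturality g)
    rw [Iso.symm_hom, Iso.symm_hom, ← E.push_pull, ← E.pull_comp, Iso.inv_hom_id, E.pull_id]

end Existence

/-! ### Units, counits and components on higher extensions -/

section Higher

variable {C : Type u} [Category.{v} C] [Preadditive C]

lemma BifunctorHom.diamond_app_mk {D : Type u₁} [Category.{v₁} D] [Preadditive D]
    {E : AddBifunctor.{u, v, w} C} {G : AddBifunctor.{u, v, w₂} C}
    {E' : AddBifunctor.{u₁, v₁, w₁} D} {G' : AddBifunctor.{u₁, v₁, u₂} D}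
    {F : C ⥤ D} (Γ : BifunctorHom E E' F) (Γ' : BifunctorHom G G' F) {A B M : C}
    (x : E.obj M B) (y : G.obj A M) :
    (Γ.diamond Γ').app A B (Diamond.mk x y) = Diamond.mk (Γ.app M B x) (Γ'.app A M y) :=
  Diamond.map_mk Γ Γ' x y

/-- On `x ⊗ y` the unit acts on `x`, is exchanged there for a pull-back along the unit at the middle
object `M`, crosses the tensor sign, and is exchanged once more by induction. -/
lemma BifunctorHom.unit_higher {D : Type u₁} [Category.{v₁} D] [Preadditive D]
    {E : AddBifunctor.{u, v, w} C} {E' : AddBifunctor.{u₁, v₁, w₁} D} {F : C ⥤ D} {G : D ⥤ C}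
    (Γ : BifunctorHom E E' F) (Γ' : BifunctorHom E' E G) (α : ∀ A, A ⟶ G.obj (F.obj A))
    (h : ∀ (A B : C) (x : E.obj A B),
      E.push (α B) x = E.pull (α A) (Γ'.app _ _ (Γ.app A B x))) :
    ∀ (n : ℕ) (A B : C) (x : (E.higher n).obj A B), (E.higher n).push (α B) x =
      (E.higher n).pull (α A) ((Γ'.higher n).app _ _ ((Γ.higher n).app A B x))
  | 0, A, B, x => congrArg ULift.up (h A B x.down)
  | n + 1, A, B, z => by
    refine Diamond.hom_congr (φ := (E.higher (n + 1)).push (α B))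
      (ψ := ((E.higher (n + 1)).pull (α A)).comp
        (((Γ'.higher (n + 1)).app _ _).comp ((Γ.higher (n + 1)).app A B))) (fun M x y => ?_) z
    have e : (Γ'.higher (n + 1)).app _ _ ((Γ.higher (n + 1)).app A B (Diamond.mk x y)) =
        Diamond.mk (Γ'.app _ _ (Γ.app M B x))
          ((Γ'.higher n).app _ _ ((Γ.higher n).app A M y)) :=
      (congrArg _ (BifunctorHom.diamond_app_mk Γ (Γ.higher n) x y)).trans
        (BifunctorHom.diamond_app_mk Γ' (Γ'.higher n) _ _)
    refine Eq.trans ?_ (congrArg ((E.higher (n + 1)).pull (α A)) e.symm)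
    refine (Diamond.push_mk _ _ _).trans (Eq.trans ?_ (Diamond.pull_mk _ _ _).symm)
    rw [h, Diamond.mk_balance, unit_higher Γ Γ' α h n]

lemma BifunctorHom.counit_higher {D : Type u₁} [Category.{v₁} D] [Preadditive D]
    {E : AddBifunctor.{u, v, w} C} {E' : AddBifunctor.{u₁, v₁, w₁} D} {F : C ⥤ D} {G : D ⥤ C}
    (Γ : BifunctorHom E E' F) (Γ' : BifunctorHom E' E G) (α : ∀ A, G.obj (F.obj A) ⟶ A)
    (h : ∀ (A B : C) (x : E.obj A B),
      E.push (α B) (Γ'.app _ _ (Γ.app A B x)) = E.pull (α A) x) :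
    ∀ (n : ℕ) (A B : C) (x : (E.higher n).obj A B),
      (E.higher n).push (α B) ((Γ'.higher n).app _ _ ((Γ.higher n).app A B x)) =
        (E.higher n).pull (α A) x
  | 0, A, B, x => congrArg ULift.up (h A B x.down)
  | n + 1, A, B, z => by
    refine Diamond.hom_congr (φ := ((E.higher (n + 1)).push (α B)).comp
        (((Γ'.higher (n + 1)).app _ _).comp ((Γ.higher (n + 1)).app A B)))
      (ψ := (E.higher (n + 1)).pull (α A)) (fun M x y => ?_) z
    have e : (Γ'.higher (n + 1)).app _ _ ((Γ.higher (n + 1)).app A B (Diamond.mk x y)) =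
        Diamond.mk (Γ'.app _ _ (Γ.app M B x))
          ((Γ'.higher n).app _ _ ((Γ.higher n).app A M y)) :=
      (congrArg _ (BifunctorHom.diamond_app_mk Γ (Γ.higher n) x y)).trans
        (BifunctorHom.diamond_app_mk Γ' (Γ'.higher n) _ _)
    refine (congrArg ((E.higher (n + 1)).push (α B)) e).trans ?_
    refine (Diamond.push_mk _ _ _).trans (Eq.trans ?_ (Diamond.pull_mk _ _ _).symm)
    rw [h, Diamond.mk_balance, counit_higher Γ Γ' α h n]

variable {E : ExtData.{u, v, w} C} {I : Type t}

lemma components_pull (n : ℕ) {X X' Y : I → C} (f : X' ⟶ X) (η : ((E.pi I).higher n).obj X Y)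
    (i : I) : components E I n X' Y (((E.pi I).higher n).pull f η) i =
      (E.higher n).pull (f i) (components E I n X Y η i) :=
  ((evalHom E I i).higher n).app_pull f η

lemma components_push (n : ℕ) {X Y Y' : I → C} (g : Y ⟶ Y') (η : ((E.pi I).higher n).obj X Y)
    (i : I) : components E I n X Y' (((E.pi I).higher n).push g η) i =
      (E.higher n).push (g i) (components E I n X Y η i) :=
  ((evalHom E I i).higher n).app_push g η

variable [HasBinaryBiproducts C] (E I)

/-- With one tensor `x i ⊗ y i` per index, the middle objects form an object `M` of the product
category; only the family `y` remains to be lifted. -/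
lemma components_surjective : ∀ (n : ℕ) (X Y : I → C), Function.Surjective (components E I n X Y)
  | 0, X, Y, z => ⟨⟨fun i => (z i).down⟩, rfl⟩
  | n + 1, X, Y, z => by
    choose M x y h using fun i => Diamond.exists_mk (z i)
    obtain ⟨y', hy'⟩ := components_surjective n X M y
    refine ⟨Diamond.mk (E := (E.pi I).toAddBifunctor) (M := M) x y', funext fun i => ?_⟩
    refine (BifunctorHom.diamond_app_mk (evalHom E I i) ((evalHom E I i).higher n) _ _).trans ?_
    rw [h i, ← hy']
    rfl

lemma components_constExt : ∀ (n : ℕ) (A B : C) (η : (E.higher n).obj A B) (i : I),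
    components E I n _ _ (((constExt E I).toBifunctorHom.higher n).app A B η) i = η
  | 0, A, B, η, i => rfl
  | n + 1, A, B, z, i => by
    obtain ⟨M, x, y, rfl⟩ := Diamond.exists_mk z
    refine (congrArg (((evalHom E I i).higher (n + 1)).app _ _)
      (BifunctorHom.diamond_app_mk (constExt E I).toBifunctorHom _ x y)).trans ?_
    refine (BifunctorHom.diamond_app_mk (evalHom E I i) ((evalHom E I i).higher n) _ _).trans ?_
    exact congrArg (Diamond.mk x) (components_constExt n A M y i)

end Higher

/-! ### Higher extensions out of a coproduct -/

section Coproducts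

variable {C : Type u} [Category.{v} C] [Preadditive C]
variable {E : ExtData.{u, v, w} C} {I : Type t} [HasCoproductsOfShape I C]

/-- The map `𝔼ⁿ(∐ D, X) ⟶ 𝔽ⁿ(D, TX)` given by `η ↦ Tⁿ(η) · φ`. -/
def toPiHigher (E : ExtData.{u, v, w} C) (n : ℕ) (D : I → C) (X : C)
    (η : (E.higher n).obj (∐ D) X) : ((E.pi I).higher n).obj D ((constFunctor C I).obj X) :=
  ((E.pi I).higher n).pull ((coprodUnit C I).app D)
    (((constExt E I).toBifunctorHom.higher n).app (∐ D) X η)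

variable (Γ : ExtFunctor (E.pi I) E (coprodFunctor C I))

/-- Naturality moves `∇` outside, the unit identity replaces `TⁿΓⁿ(η) · φ` by `φ · η`, and the
triangle identity `φ ≫ T∇ = 𝟙` removes what is left. -/
lemma toPiHigher_push_codiagonal
    (hΓ : IsExtNat (ExtFunctor.id (E.pi I)) (Γ.comp (constExt E I)) (coprodUnit C I)) (n : ℕ)
    (D : I → C) (X : C) (η : ((E.pi I).higher n).obj D ((constFunctor C I).obj X)) :
    toPiHigher E n D X ((E.higher n).push (codiagonal I X) ((Γ.higher n).app D _ η)) = η := by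
  have h := BifunctorHom.unit_higher Γ.toBifunctorHom (constExt E I).toBifunctorHom
    (fun A => (coprodUnit C I).app A) hΓ n D ((constFunctor C I).obj X) η
  have h' := ((constExt E I).toBifunctorHom.higher n).app_push (codiagonal I X)
    ((Γ.higher n).app D _ η)
  refine (congrArg _ h').trans ?_
  rw [← ((E.pi I).higher n).push_pull]
  refine (congrArg _ h.symm).trans ?_
  rw [← ((E.pi I).higher n).push_comp]
  refine Eq.trans ?_ (((E.pi I).higher n).push_id η)
  congr 2
  exact funext fun i => Limits.Sigma.ι_desc _ _

variable [HasBinaryBiproducts C]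

lemma components_toPiHigher (n : ℕ) (D : I → C) (X : C) (η : (E.higher n).obj (∐ D) X) (i : I) :
    components E I n _ _ (toPiHigher E n D X η) i = (E.higher n).pull (Limits.Sigma.ι D i) η :=
  (components_pull n _ _ i).trans (congrArg _ (components_constExt E I n _ _ η i))

lemma exists_pull_ι_eq
    (hΓ : IsExtNat (ExtFunctor.id (E.pi I)) (Γ.comp (constExt E I)) (coprodUnit C I)) (n : ℕ)
    (D : I → C) (X : C) (z : ∀ i, (E.higher n).obj (D i) X) :
    ∃ η : (E.higher n).obj (∐ D) X, ∀ i, (E.higher n).pull (Limits.Sigma.ι D i) η = z i := by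
  obtain ⟨ζ, rfl⟩ := components_surjective E I n D ((constFunctor C I).obj X) z
  refine ⟨(E.higher n).push (codiagonal I X) ((Γ.higher n).app D _ ζ), fun i => ?_⟩
  rw [← components_toPiHigher, toPiHigher_push_codiagonal Γ hΓ]

variable [HasZeroObject C]

/-- For `x ⊗ y`, the criterion lifts each restriction of `y` along the deflation `g` of `x`. The
lifts glue to `w'`, the induction hypothesis gives `g · w' = y`, and `x ⊗ (g · w') = (x · g) ⊗ w' =
0`. -/
lemma higher_eq_zero_of_pull_ι (hE : E.IsExtriangulated)
    (hΓ : IsExtNat (ExtFunctor.id (E.pi I)) (Γ.comp (constExt E I)) (coprodUnit C I)) :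
    ∀ (n : ℕ) (D : I → C) (X : C) (η : (E.higher n).obj (∐ D) X),
      (∀ i, (E.higher n).pull (Limits.Sigma.ι D i) η = 0) → η = 0
  | 0, D, X, η, h => congrArg ULift.up
      (hE.eq_zero_of_pull_ι η.down fun i => congrArg ULift.down (h i))
  | n + 1, D, X, z, h => by
    obtain ⟨M, x, y, rfl⟩ := Diamond.exists_mk z
    obtain ⟨N, f, g, hx⟩ := E.exists_realizes x
    choose w hw using fun i => HalfExact.exists_push_eq_of_mk_eq_zero hE
      (halfExact_higher hE n) hx
      ((Diamond.pull_mk _ _ _).symm.trans (h i))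
    obtain ⟨w', hw'⟩ := exists_pull_ι_eq Γ hΓ n D N w
    have hy : (E.higher n).push g w' = y := by
      refine sub_eq_zero.1 (higher_eq_zero_of_pull_ι hE hΓ n D M _ fun i => ?_)
      rw [map_sub, ← (E.higher n).push_pull, hw', hw, sub_self]
    rw [← hy, ← Diamond.mk_balance, hE.pull_deflation hx]
    exact Diamond.mk_zero_left _

end Coproducts

/-! ### Higher extensions into a product -/

section Products

variable {C : Type u} [Category.{v} C] [Preadditive C]
variable {E : ExtData.{u, v, w} C} {I : Type t} [HasProductsOfShape I C]

/-- The map `𝔼ⁿ(X, ∏ D) ⟶ 𝔽ⁿ(TX, D)` given by `η ↦ π · Tⁿ(η)`. -/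
def ofPiHigher (E : ExtData.{u, v, w} C) (n : ℕ) (D : I → C) (X : C)
    (η : (E.higher n).obj X (∏ᶜ D)) : ((E.pi I).higher n).obj ((constFunctor C I).obj X) D :=
  ((E.pi I).higher n).push ((prodCounit C I).app D)
    (((constExt E I).toBifunctorHom.higher n).app X (∏ᶜ D) η)

variable (Γ : ExtFunctor (E.pi I) E (prodFunctor C I))

lemma ofPiHigher_pull_diagonal
    (hΓ : IsExtNat (Γ.comp (constExt E I)) (ExtFunctor.id (E.pi I)) (prodCounit C I)) (n : ℕ)
    (D : I → C) (X : C) (η : ((E.pi I).higher n).obj ((constFunctor C I).obj X) D) :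
    ofPiHigher E n D X ((E.higher n).pull (diagonal I X) ((Γ.higher n).app _ D η)) = η := by
  have h := BifunctorHom.counit_higher Γ.toBifunctorHom (constExt E I).toBifunctorHom
    (fun A => (prodCounit C I).app A) hΓ n ((constFunctor C I).obj X) D η
  have h' := ((constExt E I).toBifunctorHom.higher n).app_pull (diagonal I X)
    ((Γ.higher n).app _ D η)
  refine (congrArg _ h').trans ?_
  rw [((E.pi I).higher n).push_pull]
  refine (congrArg _ h).trans ?_
  rw [← ((E.pi I).higher n).pull_comp]
  refine Eq.trans ?_ (((E.pi I).higher n).pull_id η)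
  congr 2
  exact funext fun i => Limits.Pi.lift_π _ _

variable [HasBinaryBiproducts C]

lemma components_ofPiHigher (n : ℕ) (D : I → C) (X : C) (η : (E.higher n).obj X (∏ᶜ D)) (i : I) :
    components E I n _ _ (ofPiHigher E n D X η) i = (E.higher n).push (Limits.Pi.π D i) η :=
  (components_push n _ _ i).trans (congrArg _ (components_constExt E I n _ _ η i))

lemma exists_push_π_eq
    (hΓ : IsExtNat (Γ.comp (constExt E I)) (ExtFunctor.id (E.pi I)) (prodCounit C I)) (n : ℕ)
    (D : I → C) (X : C) (z : ∀ i, (E.higher n).obj X (D i)) :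
    ∃ η : (E.higher n).obj X (∏ᶜ D), ∀ i, (E.higher n).push (Limits.Pi.π D i) η = z i := by
  obtain ⟨ζ, rfl⟩ := components_surjective E I n ((constFunctor C I).obj X) D z
  refine ⟨(E.higher n).pull (diagonal I X) ((Γ.higher n).app _ D ζ), fun i => ?_⟩
  rw [← components_ofPiHigher, ofPiHigher_pull_diagonal Γ hΓ]

variable [HasZeroObject C]

/-- Unlike for coproducts, the projections act on `x`, so the deflations `g i` onto `M` vary with
`i`. They are combined into one by `Γ`: the product extension `x'` has deflation `∏ g` and satisfies
`x = x' · Δ`. -/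
lemma higher_eq_zero_of_push_π (hE : E.IsExtriangulated)
    (hΓ : IsExtNat (Γ.comp (constExt E I)) (ExtFunctor.id (E.pi I)) (prodCounit C I)) :
    ∀ (n : ℕ) (D : I → C) (X : C) (η : (E.higher n).obj X (∏ᶜ D)),
      (∀ i, (E.higher n).push (Limits.Pi.π D i) η = 0) → η = 0
  | 0, D, X, η, h => congrArg ULift.up
      (hE.eq_zero_of_push_π η.down fun i => congrArg ULift.down (h i))
  | n + 1, D, X, z, h => by
    obtain ⟨M, x, y, rfl⟩ := Diamond.exists_mk z
    choose N f g hx using fun i => E.exists_realizes (E.push (Limits.Pi.π D i) x)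
    choose w hw using fun i => HalfExact.exists_push_eq_of_mk_eq_zero hE
      (halfExact_higher hE n) (hx i)
      ((Diamond.push_mk _ _ _).symm.trans (h i))
    obtain ⟨w', hw'⟩ := exists_push_π_eq Γ hΓ n N X w
    obtain ⟨x', hx', hr⟩ : ∃ x' : E.obj (∏ᶜ fun _ : I => M) (∏ᶜ D),
        (∀ i, E.push (Limits.Pi.π D i) x' =
          E.pull (Limits.Pi.π (fun _ => M) i) (E.push (Limits.Pi.π D i) x)) ∧
        E.Realizes x' (Limits.Pi.map f) (Limits.Pi.map g) :=
      ⟨Γ.app (fun _ => M) D fun i => E.push (Limits.Pi.π D i) x,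
        fun i => congrFun (hΓ (fun _ => M) D fun i => E.push (Limits.Pi.π D i) x) i,
        Γ.realizes (A := fun _ => M) (B := D) (M := N) hx⟩
    have hxx : E.pull (Limits.Pi.lift fun _ => 𝟙 M) x' = x := hE.push_π_ext fun i => by
      rw [E.push_pull, hx', ← E.pull_comp, Limits.Pi.lift_π, E.pull_id]
    -- Both sides have all projections equal to `y`, so the induction hypothesis applies with the
    -- constant family `M`. Hence `x ⊗ y = x' ⊗ (Δ · y) = (x' · ∏ g) ⊗ w' = 0`.
    have hy : (E.higher n).push (Limits.Pi.map g) w' =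
        (E.higher n).push (Limits.Pi.lift fun _ => 𝟙 M) y := by
      refine sub_eq_zero.1 (higher_eq_zero_of_push_π hE hΓ n _ X _ fun i => ?_)
      rw [map_sub, ← (E.higher n).push_comp, ← (E.higher n).push_comp, Limits.Pi.map_π,
        Limits.Pi.lift_π, (E.higher n).push_comp, hw', hw, (E.higher n).push_id, sub_self]
    rw [← hxx, Diamond.mk_balance, ← hy, ← Diamond.mk_balance, hE.pull_deflation hr]
    exact Diamond.mk_zero_left _

end Products

end Extriangulated

end

/-- Higher extensions and coproducts (products) indexed by a non-empty set `I`, in an AET4(`I`)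
(AET4*(`I`)) extriangulated category. The bifunctor `E.higher n` is `𝔼ⁿ⁺¹`, so `n : ℕ` runs through
the exponents `n + 1 ≥ 1`. The maps `σ` are the inverses `(τ D X).symm`. -/
theorem theoremB {C : Type u} [Category.{v} C] [Preadditive C]
    [HasZeroObject C] [HasBinaryBiproducts C] (E : ExtData.{u, v, w} C) (hE : E.IsExtriangulated)
    (I : Type t) [Nonempty I] :
    (∀ [HasCoproductsOfShape I C], E.AET4 I →
      (∃ Γ : ExtFunctor (E.pi I) E (coprodFunctor C I),
        IsExtNat (ExtFunctor.id (E.pi I)) (Γ.comp (constExt E I)) (coprodUnit C I)) ∧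
      ∀ Γ : ExtFunctor (E.pi I) E (coprodFunctor C I),
        IsExtNat (ExtFunctor.id (E.pi I)) (Γ.comp (constExt E I)) (coprodUnit C I) →
        ∀ n : ℕ,
          (∀ (D : I → C) (X : C),
            Function.Bijective (components E I n D ((constFunctor C I).obj X))) ∧
          ∃ τ : ∀ (D : I → C) (X : C),
              (E.higher n).obj (∐ D) X ≃+ ∀ i, (E.higher n).obj (D i) X,
            (∀ (D : I → C) (X : C) (η : (E.higher n).obj (∐ D) X),
              τ D X η = fun i => (E.higher n).pull (Limits.Sigma.ι D i) η) ∧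
            (∀ (D : I → C) (X : C)
                (η : ((E.pi I).higher n).obj D ((constFunctor C I).obj X)),
              (τ D X).symm (components E I n D ((constFunctor C I).obj X) η) =
                (E.higher n).push (codiagonal I X)
                  ((Γ.higher n).app D ((constFunctor C I).obj X) η)) ∧
            (∀ (D D' : I → C) (X X' : C) (f : D' ⟶ D) (g : X ⟶ X')
                (η : (E.higher n).obj (∐ D) X),
              τ D' X' ((E.higher n).push g ((E.higher n).pull (Limits.Sigma.map f) η)) =
                fun i => (E.higher n).push g ((E.higher n).pull (f i) (τ D X η i)))) ∧
    (∀ [HasProductsOfShape I C], E.AET4Star I →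
      (∃ Γ : ExtFunctor (E.pi I) E (prodFunctor C I),
        IsExtNat (Γ.comp (constExt E I)) (ExtFunctor.id (E.pi I)) (prodCounit C I)) ∧
      ∀ Γ : ExtFunctor (E.pi I) E (prodFunctor C I),
        IsExtNat (Γ.comp (constExt E I)) (ExtFunctor.id (E.pi I)) (prodCounit C I) →
        ∀ n : ℕ,
          (∀ (D : I → C) (X : C),
            Function.Bijective (components E I n ((constFunctor C I).obj X) D)) ∧
          ∃ τ : ∀ (D : I → C) (X : C),
              (E.higher n).obj X (∏ᶜ D) ≃+ ∀ i, (E.higher n).obj X (D i),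
            (∀ (D : I → C) (X : C) (η : (E.higher n).obj X (∏ᶜ D)),
              τ D X η = fun i => (E.higher n).push (Limits.Pi.π D i) η) ∧
            (∀ (D : I → C) (X : C)
                (η : ((E.pi I).higher n).obj ((constFunctor C I).obj X) D),
              (τ D X).symm (components E I n ((constFunctor C I).obj X) D η) =
                (E.higher n).pull (diagonal I X)
                  ((Γ.higher n).app ((constFunctor C I).obj X) D η)) ∧
            (∀ (D D' : I → C) (X X' : C) (f : D ⟶ D') (g : X' ⟶ X)
                (η : (E.higher n).obj X (∏ᶜ D)),
              τ D' X' ((E.higher n).push (Limits.Pi.map f) ((E.higher n).pull g η)) =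
                fun i => (E.higher n).push (f i) ((E.higher n).pull g (τ D X η i)))) := by
  refine ⟨fun h => ?_, fun h => ?_⟩
  · refine ⟨exists_extFunctor_of_coprodCompatible hE (h.coprodCompatible hE), fun Γ hΓ n => ?_⟩
    have hinj : ∀ (D : I → C) (X : C) (η η' : (E.higher n).obj (∐ D) X),
        (∀ i, (E.higher n).pull (Limits.Sigma.ι D i) η =
          (E.higher n).pull (Limits.Sigma.ι D i) η') → η = η' := fun D X η η' hη =>
      sub_eq_zero.1 (higher_eq_zero_of_pull_ι Γ hE hΓ n D X _ fun i => by
        rw [map_sub, hη, sub_self])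
    refine ⟨fun D X => ⟨fun η η' hη => ?_, components_surjective E I n _ _⟩,
      fun D X => AddEquiv.ofBijective
        (AddMonoidHom.pi fun i => (E.higher n).pull (Limits.Sigma.ι D i))
        ⟨fun η η' hη => hinj D X η η' (congrFun hη), fun z => ?_⟩,
      fun D X η => rfl, fun D X η => ?_, fun D D' X X' f g η => funext fun i => ?_⟩
    -- Injectivity of the component map: each element is recovered from its image under `σ`, and
    -- these images agree because `τ` is injective.
    · rw [← toPiHigher_push_codiagonal Γ hΓ n D X η,
        ← toPiHigher_push_codiagonal Γ hΓ n D X η'] at hη ⊢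
      refine congrArg _ (hinj D X _ _ fun i => ?_)
      rw [← components_toPiHigher, ← components_toPiHigher, hη]
    · obtain ⟨η, hη⟩ := exists_pull_ι_eq Γ hΓ n D X z
      exact ⟨η, funext hη⟩
    · refine (AddEquiv.symm_apply_eq _).2 (funext fun i => ?_)
      refine Eq.trans ?_ (components_toPiHigher n D X _ i)
      exact congrFun (congrArg _ (toPiHigher_push_codiagonal Γ hΓ n D X η).symm) i
    · change (E.higher n).pull (Limits.Sigma.ι D' i) _ =
        (E.higher n).push g ((E.higher n).pull (f i) ((E.higher n).pull (Limits.Sigma.ι D i) η))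
      rw [← (E.higher n).push_pull, ← (E.higher n).pull_comp, ← (E.higher n).pull_comp,
        Limits.Sigma.ι_map]
  · refine ⟨exists_extFunctor_of_prodCompatible hE
      (prodCompatible_of_op hE (ExtData.AET4.coprodCompatible hE.op h)), fun Γ hΓ n => ?_⟩
    have hinj : ∀ (D : I → C) (X : C) (η η' : (E.higher n).obj X (∏ᶜ D)),
        (∀ i, (E.higher n).push (Limits.Pi.π D i) η =
          (E.higher n).push (Limits.Pi.π D i) η') → η = η' := fun D X η η' hη =>
      sub_eq_zero.1 (higher_eq_zero_of_push_π Γ hE hΓ n D X _ fun i => by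
        rw [map_sub, hη, sub_self])
    refine ⟨fun D X => ⟨fun η η' hη => ?_, components_surjective E I n _ _⟩,
      fun D X => AddEquiv.ofBijective
        (AddMonoidHom.pi fun i => (E.higher n).push (Limits.Pi.π D i))
        ⟨fun η η' hη => hinj D X η η' (congrFun hη), fun z => ?_⟩,
      fun D X η => rfl, fun D X η => ?_, fun D D' X X' f g η => funext fun i => ?_⟩
    -- As for coproducts, each element is recovered from its image in `𝔼ⁿ⁺¹(X, ∏ D)`, where
    -- projections detect equality.
    · rw [← ofPiHigher_pull_diagonal Γ hΓ n D X η,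
        ← ofPiHigher_pull_diagonal Γ hΓ n D X η'] at hη ⊢
      refine congrArg _ (hinj D X _ _ fun i => ?_)
      rw [← components_ofPiHigher, ← components_ofPiHigher, hη]
    · obtain ⟨η, hη⟩ := exists_push_π_eq Γ hΓ n D X z
      exact ⟨η, funext hη⟩
    · refine (AddEquiv.symm_apply_eq _).2 (funext fun i => ?_)
      refine Eq.trans ?_ (components_ofPiHigher n D X _ i)
      exact congrFun (congrArg _ (ofPiHigher_pull_diagonal Γ hΓ n D X η).symm) i
    · change (E.higher n).push (Limits.Pi.π D' i) _ =
        (E.higher n).push (f i) ((E.higher n).pull g ((E.higher n).push (Limits.Pi.π D i) η))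
      rw [← (E.higher n).push_pull, ← (E.higher n).push_comp, ← (E.higher n).push_comp,
        Limits.Pi.map_π]
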